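/- Let $W$ be a $4$-dimensional complex vector space with a hyper-Hermitian structure, i.e. a complex $2$-form $\pi$ and an anti-linear map $j:W\to W$ with $j^2=-\mathrm{Id}$, $\pi(jx,jy)=\overline{\pi(x,y)}$ and $\pi(x,jx)>0$ for $x\neq 0$. Let $V$ be the real vector space underlying $W$, with $J_1=i$, $J_2=j$, $J_3=J_1J_2$ and the inner product $g(x,y)=2\,\mathrm{Re}\,\pi(x,jy)$. Identify $W$ with the $i$-eigenspace of $J_1$ in $V^{\mathbb C}=V\otimes_{\mathbb R}\mathbb C$ by $w\mapsto\frac12(w-i\otimes J_1w)$, so that $V^{\mathbb C}=W\oplus\overline W$. $\bullet$ $\mathfrak S^{Sp(2)}$ is the real vector space of totally symmetric complex $4$-tensors $S\in S^4(W^*)+S^4(\overline W^*)$ on $V^{\mathbb C}$ with $\overline{S(x,y,z,w)}=S(\bar x,\bar y,\bar z,\bar w)$ and $S(J_2x,J_2y,J_2z,J_2w)=S(x,y,z,w)$. $\bullet$ $\mathfrak R^{Sp(2)}$ is the space of $K\in\Lambda^2V^*\otimes\Lambda^2V^*$ with $K(x,y,z,w)+K(y,z,x,w)+K(z,x,y,w)=0$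 and $K(x,y,J_sz,J_sw)=K(x,y,z,w)$ for $s=1,2,3$. The map $\mathcal K:\mathfrak S^{Sp(2)}\to\mathfrak R^{Sp(2)}$ is $\mathcal K(S)(x,y,z,w)=S(x,J_2y,z,J_2w)-S(x,J_2y,J_2z,w)$ for $x,y,z,w\in V$; it is injective. $\bullet$ $sp(2)$ is the Lie algebra (under the commutator) of the $A\in\mathrm{End}(V)$ with $g(Ax,y)+g(x,Ay)=0$ and $AJ_s=J_sA$ for $s=1,2,3$. For $K\in\mathfrak R^{Sp(2)}$ the operator $\mathcal T_K$ on $sp(2)$ is given by $g(\mathcal T_K(A)x,y)=\frac12\sum_{a=1}^{8}K(x,y,h_a,Ah_a)$, where $\{h_a\}$ is any $g$-orthonormal basis of $V$, and $\mathcal P=\frac15\mathcal T_K+\frac3{10}\mathrm{Id}$. $\bullet$ A basis $e_1,\dots,e_4$ of $W$, with dual basis $e^1,\dots,e^4$, is $Sp(2)$-adapted if $e_3=j(e_1)$, $e_4=j(e_2)$ and $\pi=e^1\wedge e^3+e^2\wedge e^4$. Put $S_{\alpha\beta\gamma\delta}=S(e_\alpha,e_\beta,e_\gamma,e_\delta)$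 and $\pi_{\alpha\beta}=\pi(e_\alpha,e_\beta)$, and let $\pi^{\alpha\beta}=g^{\alpha\bar\sigma}g^{\beta\bar\tau}\overline{\pi_{\sigma\tau}}$, where $g^{\alpha\bar\beta}$ is the inverse of $g_{\alpha\bar\beta}=\pi(e_\alpha,j e_\beta)$ (in an adapted basis $g_{\alpha\bar\beta}=\delta_{\alpha\beta}$ and $\pi^{\alpha\beta}=\pi_{\alpha\beta}$ numerically). Repeated indices are summed from $1$ to $4$. $\bullet$ $\mathcal C\subset\mathfrak R^{Sp(2)}$ is the set of all $K=\mathcal K(S)$, $S\in\mathfrak S^{Sp(2)}$, such that with respect to some $Sp(2)$-adapted basis $\{e_\alpha\}$, for all $x=x^\alpha e_\alpha\in W$, $$S(x,x,x,x)=-18x^1x^2x^3x^4+4\sqrt3\,x^1(x^4)^3-4\sqrt3\,(x^2)^3x^3+3(x^2)^2(x^4)^2-9(x^1)^2(x^3)^2 .$$ **Statement.** Let $\{e_\alpha\}$ be any $Sp(2)$-adapted basis of $W$ and let $S\in\mathfrak S^{Sp(2)}$. Then $\mathcal K(S)\in\mathcal C$ if and only if the following two conditions hold: (I) for all $\alpha,\beta,\gamma,\delta$: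 $\ \pi^{\sigma\tau}\pi^{\mu\nu}S_{\sigma\mu\alpha\beta}S_{\tau\nu\gamma\delta}=2S_{\alpha\beta\gamma\delta}+\frac{21}{8}\big(\pi_{\alpha\gamma}\pi_{\beta\delta}+\pi_{\alpha\delta}\pi_{\beta\gamma}\big)$; (II) for all $\mu,\nu$ and all $x^1,x^2,x^3,x^4\in\mathbb C$: $\ \sum_{\alpha,\beta,\gamma,\delta}\big(\pi^{\sigma\tau}S_{\sigma\alpha\beta\gamma}S_{\tau\delta\mu\nu}+\frac34S_{\alpha\beta\gamma\mu}\pi_{\nu\delta}+\frac34S_{\alpha\beta\gamma\nu}\pi_{\mu\delta}\big)x^\alpha x^\beta x^\gamma x^\delta=0$. Furthermore, with $K=\mathcal K(S)$ and $\mathcal P=\frac15\mathcal T_K+\frac3{10}\mathrm{Id}$, condition (I) is equivalent to $\mathcal P^2=\mathcal P$, and condition (II) is equivalent to $[\mathcal PA,\mathcal PB]=\mathcal P[\mathcal PA,B]$ for all $A,B\in sp(2)$. -/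

import Mathlib

open scoped TensorProduct ComplexOrder

attribute [local instance 100] LieRing.ofAssociativeRing

/-- A hyper-Hermitian structure on a complex vector space `W`: a complex `2`-form `π` and an
anti-linear map `j` with `j² = -1`, `π(jx, jy) = conj π(x, y)` and `π(x, jx) > 0` for `x ≠ 0`
(in particular `π` is non-degenerate; `0 < z` for a complex `z` means that `z` is a positive
real number). -/
structure HyperHermitian (W : Type*) [AddCommGroup W] [Module ℂ W] where
  π : W →ₗ[ℂ] W →ₗ[ℂ] ℂ
  j : W →ₛₗ[starRingEnd ℂ] W
  π_self : ∀ x, π x x = 0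
  j_j : ∀ x, j (j x) = -x
  π_j_j : ∀ x y, π (j x) (j y) = starRingEnd ℂ (π x y)
  π_pos : ∀ x, x ≠ 0 → 0 < π x (j x)

namespace HyperHermitian

noncomputable section

variable {W : Type*} [AddCommGroup W] [Module ℂ W]

/-! ### The real space `V`, its structure, and its complexification

`V` is the real vector space underlying `W`; in the code it is `W` itself, as a module over `ℝ`.
-/

/-- The complex structure `J₁`, multiplication by `i`. -/
def J₁ (_H : HyperHermitian W) : Module.End ℝ W where
  toFun x := Complex.I • x
  map_add' := smul_add _
  map_smul' _ _ := smul_comm _ _ _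

/-- The complex structure `J₂`, which is `j` regarded as a real endomorphism of `V`. -/
def J₂ (H : HyperHermitian W) : Module.End ℝ W where
  toFun x := H.j x
  map_add' := map_add _
  map_smul' c x := by
    rw [← algebraMap_smul ℂ c x, H.j.map_smulₛₗ, ← algebraMap_smul ℂ _ (H.j x)]
    simp

/-- The complex structure `J₃ = J₁ J₂`. -/
def J₃ (H : HyperHermitian W) : Module.End ℝ W := H.J₁ * H.J₂

/-- The triple `J₁, J₂, J₃`, indexed from `0`. -/
def J (H : HyperHermitian W) : Fin 3 → Module.End ℝ W := ![H.J₁, H.J₂, H.J₃]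

@[simp] theorem J₁_apply (H : HyperHermitian W) (x : W) : H.J₁ x = Complex.I • x := rfl
@[simp] theorem J₂_apply (H : HyperHermitian W) (x : W) : H.J₂ x = H.j x := rfl
@[simp] theorem J₃_apply (H : HyperHermitian W) (x : W) : H.J₃ x = Complex.I • H.j x := rfl

/-- The inner product `g(x, y) = π(x, J₂ y)` on `V`. Here `π` is extended from `W` to a real
form on `V`; its value at `x, y ∈ V` is `π(x, y) + conj π(x, y)`, whence the `2 Re`. -/
def g (H : HyperHermitian W) : W →ₗ[ℝ] W →ₗ[ℝ] ℝ :=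
  LinearMap.mk₂ ℝ (fun x y => 2 * (H.π x (H.J₂ y)).re)
    (by intro x y z; simp; ring)
    (by
      intro c x y
      rw [← algebraMap_smul ℂ c x, map_smul]
      simp; ring)
    (by intro x y z; rw [map_add, map_add]; simp; ring)
    (by
      intro c x y
      rw [map_smul, ← algebraMap_smul ℂ c (H.J₂ y), map_smul]
      simp; ring)

theorem g_apply (H : HyperHermitian W) (x y : W) : H.g x y = 2 * (H.π x (H.j y)).re := rfl

/-- The inclusion `V → V^ℂ = ℂ ⊗ V`. -/
def toVC (_H : HyperHermitian W) : W →ₗ[ℝ] ℂ ⊗[ℝ] W := TensorProduct.mk ℝ ℂ W 1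

/-- Complex conjugation on `V^ℂ`. -/
def conjVC (_H : HyperHermitian W) : ℂ ⊗[ℝ] W →ₗ[ℝ] ℂ ⊗[ℝ] W :=
  LinearMap.rTensor W Complex.conjAe.toLinearMap

/-- The `i`-eigenspace of `J₁` in `V^ℂ`, canonically isomorphic to `W`. -/
def W10 (H : HyperHermitian W) : Submodule ℂ (ℂ ⊗[ℝ] W) :=
  Module.End.eigenspace (H.J₁.baseChange ℂ) Complex.I

/-- The `(-i)`-eigenspace of `J₁` in `V^ℂ`, canonically isomorphic to the conjugate of `W`. -/
def W01 (H : HyperHermitian W) : Submodule ℂ (ℂ ⊗[ℝ] W) :=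
  Module.End.eigenspace (H.J₁.baseChange ℂ) (-Complex.I)

/-- The canonical isomorphism of `W` with the `i`-eigenspace of `J₁`: the component
`(w - i J₁ w) / 2` of `w ∈ V` in that eigenspace, so that `w = ι w + conj (ι w)`. -/
def ι (H : HyperHermitian W) (w : W) : ℂ ⊗[ℝ] W :=
  (1 / 2 : ℂ) ⊗ₜ[ℝ] w - (Complex.I / 2) ⊗ₜ[ℝ] (H.J₁ w)

theorem J₁_J₁ (H : HyperHermitian W) (x : W) : H.J₁ (H.J₁ x) = -x := by
  simp [smul_smul]

theorem ι_mem (H : HyperHermitian W) (w : W) : H.ι w ∈ H.W10 := by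
  rw [W10, Module.End.mem_eigenspace_iff, ι, map_sub, LinearMap.baseChange_tmul,
    LinearMap.baseChange_tmul, J₁_J₁, smul_sub, TensorProduct.smul_tmul', TensorProduct.smul_tmul',
    TensorProduct.tmul_neg]
  have h : Complex.I • (Complex.I / 2) = -(1 / 2 : ℂ) := by
    rw [smul_eq_mul, ← mul_div_assoc, Complex.I_mul_I]; ring
  have h' : Complex.I • (1 / 2 : ℂ) = Complex.I / 2 := by rw [smul_eq_mul]; ring
  rw [h, h', TensorProduct.neg_tmul]
  abel

theorem conj_ι_mem (H : HyperHermitian W) (w : W) : H.conjVC (H.ι w) ∈ H.W01 := by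
  have e : H.conjVC (H.ι w) = (1 / 2 : ℂ) ⊗ₜ[ℝ] w + (Complex.I / 2) ⊗ₜ[ℝ] (H.J₁ w) := by
    have h : (starRingEnd ℂ) (Complex.I / 2) = -(Complex.I / 2) := by
      rw [map_div₀, Complex.conj_I, Complex.conj_ofNat]; ring
    have h' : (starRingEnd ℂ) (1 / 2 : ℂ) = 1 / 2 := by
      rw [map_div₀, map_one, Complex.conj_ofNat]
    simp only [conjVC, ι, map_sub, LinearMap.rTensor_tmul]
    simp only [AlgEquiv.toLinearMap_apply, Complex.conjAe_coe, h, h', TensorProduct.neg_tmul]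
    abel
  rw [e, W01, Module.End.mem_eigenspace_iff, map_add, LinearMap.baseChange_tmul,
    LinearMap.baseChange_tmul, J₁_J₁, smul_add, TensorProduct.smul_tmul', TensorProduct.smul_tmul',
    TensorProduct.tmul_neg]
  have h : (-Complex.I) • (Complex.I / 2) = (1 / 2 : ℂ) := by
    rw [smul_eq_mul, ← mul_div_assoc, neg_mul, Complex.I_mul_I]; ring
  have h' : (-Complex.I) • (1 / 2 : ℂ) = -(Complex.I / 2) := by rw [smul_eq_mul]; ring
  rw [h, h', TensorProduct.neg_tmul]
  abel

theorem toVC_eq (H : HyperHermitian W) (w : W) : H.toVC w = H.ι w + H.conjVC (H.ι w) := by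
  have h : (starRingEnd ℂ) (Complex.I / 2) = -(Complex.I / 2) := by
      rw [map_div₀, Complex.conj_I, Complex.conj_ofNat]; ring
  have h' : (starRingEnd ℂ) (1 / 2 : ℂ) = 1 / 2 := by
      rw [map_div₀, map_one, Complex.conj_ofNat]
  simp only [conjVC, ι, map_sub, LinearMap.rTensor_tmul]
  simp only [AlgEquiv.toLinearMap_apply, Complex.conjAe_coe, h, h', TensorProduct.neg_tmul]
  have : H.toVC w = ((1 / 2 : ℂ) + 1 / 2) ⊗ₜ[ℝ] w := by norm_num [toVC]
  rw [this, TensorProduct.add_tmul]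
  abel

/-! ### The tensor spaces `𝔖^{Sp(n)}` and `ℜ^{Sp(n)}` and the map `𝒦` -/

/-- The real vector space `𝔖^{Sp(n)}`: the complex `4`-tensors `S` on `V^ℂ` that are totally
symmetric, lie in `S⁴(W^*) + S⁴(conj W^*)` (i.e. vanish as soon as one argument is in the
`i`-eigenspace and another one in the `(-i)`-eigenspace of `J₁`), are real, i.e.
`conj S(x, y, z, w) = S(conj x, conj y, conj z, conj w)`, and are invariant under `J₂`, i.e.
`S(J₂ x, J₂ y, J₂ z, J₂ w) = S(x, y, z, w)`. In terms of components this is `𝔧 S = S`. -/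
def symTensors (H : HyperHermitian W) :
    Submodule ℝ (MultilinearMap ℂ (fun _ : Fin 4 => ℂ ⊗[ℝ] W) ℂ) where
  carrier := {S | (∀ (τ : Equiv.Perm (Fin 4)) (v : Fin 4 → ℂ ⊗[ℝ] W), S (fun k => v (τ k)) = S v) ∧
    (∀ v, (∃ k, v k ∈ H.W10) → (∃ l, v l ∈ H.W01) → S v = 0) ∧
    (∀ v, starRingEnd ℂ (S v) = S (fun k => H.conjVC (v k))) ∧
    (∀ v, S (fun k => H.J₂.baseChange ℂ (v k)) = S v)}
  zero_mem' := by simp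
  add_mem' := by
    rintro a b ⟨h1, h2, h3, h4⟩ ⟨k1, k2, k3, k4⟩
    refine ⟨fun τ v => ?_, fun v hk hl => ?_, fun v => ?_, fun v => ?_⟩
    · simp [h1 τ v, k1 τ v]
    · simp [h2 v hk hl, k2 v hk hl]
    · simp [h3 v, k3 v]
    · simp [h4 v, k4 v]
  smul_mem' := by
    rintro c a ⟨h1, h2, h3, h4⟩
    refine ⟨fun τ v => ?_, fun v hk hl => ?_, fun v => ?_, fun v => ?_⟩
    · simp [h1 τ v]
    · simp [h2 v hk hl]
    · simp [h3 v]
    · simp [h4 v]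

/-- The real vector space `ℜ^{Sp(n)}` of hyper-Kähler curvature-type tensors: the real
`4`-tensors `K ∈ Λ² V^* ⊗ Λ² V^*` on `V` that satisfy the Bianchi identity and
`K(x, y, J_s z, J_s w) = K(x, y, z, w)` for `s = 1, 2, 3`. -/
def curvTensors (H : HyperHermitian W) :
    Submodule ℝ (MultilinearMap ℝ (fun _ : Fin 4 => W) ℝ) where
  carrier := {K | (∀ x y z w, K ![x, y, z, w] = -K ![y, x, z, w]) ∧
    (∀ x y z w, K ![x, y, z, w] = -K ![x, y, w, z]) ∧
    (∀ x y z w, K ![x, y, z, w] + K ![y, z, x, w] + K ![z, x, y, w] = 0) ∧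
    (∀ s x y z w, K ![x, y, H.J s z, H.J s w] = K ![x, y, z, w])}
  zero_mem' := by simp
  add_mem' := by
    rintro a b ⟨h1, h2, h3, h4⟩ ⟨k1, k2, k3, k4⟩
    refine ⟨fun x y z w => ?_, fun x y z w => ?_, fun x y z w => ?_, fun s x y z w => ?_⟩ <;>
      simp only [add_apply]
    · linarith [h1 x y z w, k1 x y z w]
    · linarith [h2 x y z w, k2 x y z w]
    · linarith [h3 x y z w, k3 x y z w]
    · linarith [h4 s x y z w, k4 s x y z w]
  smul_mem' := by
    rintro c a ⟨h1, h2, h3, h4⟩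
    refine ⟨fun x y z w => ?_, fun x y z w => ?_, fun x y z w => ?_, fun s x y z w => ?_⟩ <;>
      simp only [smul_apply, smul_eq_mul]
    · rw [h1 x y z w]; ring
    · rw [h2 x y z w]; ring
    · rw [← mul_add, ← mul_add, h3 x y z w, mul_zero]
    · rw [h4 s x y z w]

/-- The restriction to `V` of a complex tensor `S` on `V^ℂ`, composed with endomorphisms `A k`
of `V` in the four arguments; real part (for `S ∈ 𝔖` the values are real). -/
def restr (H : HyperHermitian W) (S : MultilinearMap ℂ (fun _ : Fin 4 => ℂ ⊗[ℝ] W) ℂ)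
    (A : Fin 4 → Module.End ℝ W) : MultilinearMap ℝ (fun _ : Fin 4 => W) ℝ :=
  Complex.reLm.compMultilinearMap
    ((S.restrictScalars ℝ).compLinearMap fun k => H.toVC ∘ₗ A k)

theorem restr_apply (H : HyperHermitian W)
    (S : MultilinearMap ℂ (fun _ : Fin 4 => ℂ ⊗[ℝ] W) ℂ) (A : Fin 4 → Module.End ℝ W)
    (v : Fin 4 → W) : H.restr S A v = (S fun k => H.toVC (A k (v k))).re := rfl

/-- The tensor `𝒦(S)(x, y, z, w) = S(x, J₂ y, z, J₂ w) - S(x, J₂ y, J₂ z, w)` on `V`. -/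
def curvOf (H : HyperHermitian W) (S : MultilinearMap ℂ (fun _ : Fin 4 => ℂ ⊗[ℝ] W) ℂ) :
    MultilinearMap ℝ (fun _ : Fin 4 => W) ℝ :=
  H.restr S ![1, H.J₂, 1, H.J₂] - H.restr S ![1, H.J₂, H.J₂, 1]

theorem fun_eq_vec {α : Type*} (f : Fin 4 → α) : f = ![f 0, f 1, f 2, f 3] := by
  funext k; fin_cases k <;> rfl

theorem curvOf_apply (H : HyperHermitian W)
    (S : MultilinearMap ℂ (fun _ : Fin 4 => ℂ ⊗[ℝ] W) ℂ) (x y z w : W) :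
    H.curvOf S ![x, y, z, w] =
      (S ![H.toVC x, H.toVC (H.J₂ y), H.toVC z, H.toVC (H.J₂ w)]).re -
        (S ![H.toVC x, H.toVC (H.J₂ y), H.toVC (H.J₂ z), H.toVC w]).re := by
  rw [curvOf, sub_apply, restr_apply, restr_apply]
  congr 3 <;> exact fun_eq_vec _

/-- The values on `V` of a tensor of `𝔖`. -/
theorem symTensors_vec (H : HyperHermitian W) {S} (hS : S ∈ H.symTensors) :
    ∃ s : W → W → W → W → ℝ,
      (∀ x y z w, S ![H.toVC x, H.toVC y, H.toVC z, H.toVC w] = (s x y z w : ℂ)) ∧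
      (∀ x y z w, s y x z w = s x y z w) ∧ (∀ x y z w, s x z y w = s x y z w) ∧
      (∀ x y z w, s x y w z = s x y z w) ∧
      (∀ x y z w, s (H.J₂ x) (H.J₂ y) (H.J₂ z) (H.J₂ w) = s x y z w) ∧
      (∀ x y z w, s (-x) y z w = -s x y z w) ∧
      (∀ x y z w, s x y (H.J₁ z) (H.J₁ w) = -s x y z w) := by
  obtain ⟨h1, h2, h3, h4⟩ := hS
  have perm : ∀ (τ : Equiv.Perm (Fin 4)) (x y z w : ℂ ⊗[ℝ] W) (v : Fin 4 → ℂ ⊗[ℝ] W),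
      v = (fun k => ![x, y, z, w] (τ k)) → S v = S ![x, y, z, w] := by
    intro τ x y z w v hv
    rw [hv, h1]
  have u2 : ∀ x y z w t : ℂ ⊗[ℝ] W, Function.update ![x, y, z, w] 2 t = ![x, y, t, w] := by
    intro x y z w t; funext k; fin_cases k <;> rfl
  have u3 : ∀ x y z w t : ℂ ⊗[ℝ] W, Function.update ![x, y, z, w] 3 t = ![x, y, z, t] := by
    intro x y z w t; funext k; fin_cases k <;> rfl
  have a2 : ∀ x y z w z' : ℂ ⊗[ℝ] W, S ![x, y, z + z', w] = S ![x, y, z, w] + S ![x, y, z', w] := by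
    intro x y z w z'
    simpa only [u2] using S.map_update_add ![x, y, z, w] 2 z z'
  have a3 : ∀ x y z w w' : ℂ ⊗[ℝ] W, S ![x, y, z, w + w'] = S ![x, y, z, w] + S ![x, y, z, w'] := by
    intro x y z w w'
    simpa only [u3] using S.map_update_add ![x, y, z, w] 3 w w'
  have m2 : ∀ (c : ℂ) (x y z w : ℂ ⊗[ℝ] W), S ![x, y, c • z, w] = c * S ![x, y, z, w] := by
    intro c x y z w
    simpa only [u2, smul_eq_mul] using S.map_update_smul ![x, y, z, w] 2 c z
  have m3 : ∀ (c : ℂ) (x y z w : ℂ ⊗[ℝ] W), S ![x, y, z, c • w] = c * S ![x, y, z, w] := by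
    intro c x y z w
    simpa only [u3, smul_eq_mul] using S.map_update_smul ![x, y, z, w] 3 c w
  have hι : ∀ z, H.ι z = (1 / 2 : ℂ) • H.toVC z + (-(Complex.I / 2)) • H.toVC (H.J₁ z) := by
    intro z
    simp only [toVC, TensorProduct.mk_apply, TensorProduct.smul_tmul', smul_eq_mul, mul_one,
      TensorProduct.neg_tmul, ι, sub_eq_add_neg]
  have hι' : ∀ z, H.conjVC (H.ι z) =
      (1 / 2 : ℂ) • H.toVC z + (Complex.I / 2) • H.toVC (H.J₁ z) := by
    intro z
    have := H.toVC_eq z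
    rw [eq_comm, ← eq_sub_iff_add_eq'] at this
    rw [this, hι]
    module
  have sw01 : ∀ x y z w : ℂ ⊗[ℝ] W, S ![y, x, z, w] = S ![x, y, z, w] := fun x y z w =>
    perm (Equiv.swap 0 1) x y z w _ (by funext k; fin_cases k <;> rfl)
  have sw12 : ∀ x y z w : ℂ ⊗[ℝ] W, S ![x, z, y, w] = S ![x, y, z, w] := fun x y z w =>
    perm (Equiv.swap 1 2) x y z w _ (by funext k; fin_cases k <;> rfl)
  have sw23 : ∀ x y z w : ℂ ⊗[ℝ] W, S ![x, y, w, z] = S ![x, y, z, w] := fun x y z w =>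
    perm (Equiv.swap 2 3) x y z w _ (by funext k; fin_cases k <;> rfl)
  have real : ∀ x y z w, (S ![H.toVC x, H.toVC y, H.toVC z, H.toVC w]).im = 0 := by
    intro x y z w
    have hc : ∀ x, H.conjVC (H.toVC x) = H.toVC x := by
      intro x; simp [conjVC, toVC]
    have := h3 ![H.toVC x, H.toVC y, H.toVC z, H.toVC w]
    rw [fun_eq_vec (fun k => H.conjVC _)] at this
    simp only [Matrix.cons_val, hc] at this
    exact Complex.conj_eq_iff_im.mp this
  refine ⟨fun x y z w => (S ![H.toVC x, H.toVC y, H.toVC z, H.toVC w]).re,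
    fun x y z w => (Complex.ext rfl (by rw [real, Complex.ofReal_im])),
    ?_, ?_, ?_, ?_, ?_, ?_⟩
  · intro x y z w; exact congrArg Complex.re (sw01 _ _ _ _)
  · intro x y z w; exact congrArg Complex.re (sw12 _ _ _ _)
  · intro x y z w; exact congrArg Complex.re (sw23 _ _ _ _)
  · intro x y z w
    have hc : ∀ x, H.J₂.baseChange ℂ (H.toVC x) = H.toVC (H.J₂ x) := by
      intro x; simp only [toVC, TensorProduct.mk_apply, LinearMap.baseChange_tmul]
    have := h4 ![H.toVC x, H.toVC y, H.toVC z, H.toVC w]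
    rw [fun_eq_vec (fun k => H.J₂.baseChange ℂ _)] at this
    simp only [Matrix.cons_val, hc] at this
    exact congrArg Complex.re this
  · intro x y z w
    have e : H.toVC (-x) = (-1 : ℂ) • H.toVC x := by simp
    have r : ∀ t, S ![t, H.toVC y, H.toVC z, H.toVC w] =
        S ![H.toVC y, H.toVC z, t, H.toVC w] :=
      fun t => (sw01 _ t _ _).trans (sw12 _ _ t _)
    simp only [e, r, m2]
    simp
  · intro x y z w
    have := h2 ![H.toVC x, H.toVC y, H.ι z, H.conjVC (H.ι w)] ⟨2, H.ι_mem z⟩ ⟨3, H.conj_ι_mem w⟩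
    rw [hι, hι', a2, a3, a3] at this
    simp only [m2, m3] at this
    have := congrArg Complex.re this
    simp [real] at this
    simp only [J₁_apply]
    linarith

theorem curvOf_mem (H : HyperHermitian W) {S} (hS : S ∈ H.symTensors) :
    H.curvOf S ∈ H.curvTensors := by
  obtain ⟨s, hs, s01, s12, s23, sJ, sn, sI⟩ := H.symTensors_vec hS
  have K : ∀ x y z w, H.curvOf S ![x, y, z, w] =
      s x (H.J₂ y) z (H.J₂ w) - s x (H.J₂ y) (H.J₂ z) w := by
    intro x y z w; rw [curvOf_apply, hs, hs, Complex.ofReal_re, Complex.ofReal_re]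
  have jj : ∀ x, H.J₂ (H.J₂ x) = -x := fun x => H.j_j x
  have sn1 : ∀ x y z w, s x (-y) z w = -s x y z w := by
    intro x y z w; rw [s01, sn, s01]
  have sn2 : ∀ x y z w, s x y (-z) w = -s x y z w := by
    intro x y z w; rw [s12, sn1, s12]
  have sn3 : ∀ x y z w, s x y z (-w) = -s x y z w := by
    intro x y z w; rw [s23, sn2, s23]
  have q : ∀ x y z w, s x (H.J₂ y) z (H.J₂ w) = s (H.J₂ x) y (H.J₂ z) w := by
    intro x y z w; rw [← sJ]; simp only [jj, sn1, sn3, neg_neg]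
  have q' : ∀ x y z w, s x (H.J₂ y) (H.J₂ z) w = s (H.J₂ x) y z (H.J₂ w) := by
    intro x y z w; rw [← sJ]; simp only [jj, sn1, sn2, neg_neg]
  have h2 : ∀ x y z w, H.curvOf S ![x, y, H.J₂ z, H.J₂ w] = H.curvOf S ![x, y, z, w] := by
    intro x y z w; rw [K, K]; simp only [jj, sn2, sn3]; ring
  have anti : ∀ x, H.J₂ (H.J₁ x) = -H.J₁ (H.J₂ x) := by
    intro x; simp [H.j.map_smulₛₗ]
  have h1 : ∀ x y z w, H.curvOf S ![x, y, H.J₁ z, H.J₁ w] = H.curvOf S ![x, y, z, w] := by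
    intro x y z w; rw [K, K, anti, anti, sn3, sn2, sI, sI]; ring
  refine ⟨?_, ?_, ?_, ?_⟩
  · intro x y z w
    rw [K, K, q y x z w, q' y x z w, s01 x (H.J₂ y), s01 x (H.J₂ y)]; ring
  · intro x y z w
    rw [K, K]; linarith [s23 x (H.J₂ y) z (H.J₂ w), s23 x (H.J₂ y) (H.J₂ z) w]
  · intro x y z w
    rw [K, K, K, q x y z w, q y z x w, q z x y w]
    linarith [s12 (H.J₂ y) (H.J₂ x) z w, s01 (H.J₂ x) (H.J₂ y) z w, s12 y (H.J₂ x) (H.J₂ z) w,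
      s01 (H.J₂ x) y (H.J₂ z) w, s01 x (H.J₂ z) (H.J₂ y) w, s12 x (H.J₂ y) (H.J₂ z) w,
      s01 (H.J₂ x) z (H.J₂ y) w, s12 (H.J₂ x) (H.J₂ y) z w]
  · intro k x y z w
    fin_cases k
    · exact h1 x y z w
    · exact h2 x y z w
    · exact (h1 x y (H.J₂ z) (H.J₂ w)).trans (h2 x y z w)

/-- The map `𝒦 : 𝔖^{Sp(n)} → ℜ^{Sp(n)}`. -/
def 𝒦 (H : HyperHermitian W) (S : H.symTensors) : H.curvTensors :=
  ⟨H.curvOf S.1, H.curvOf_mem S.2⟩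

theorem 𝒦_apply (H : HyperHermitian W) (S : H.symTensors) (x y z w : W) :
    (H.𝒦 S).1 ![x, y, z, w] =
      (S.1 ![H.toVC x, H.toVC (H.J₂ y), H.toVC z, H.toVC (H.J₂ w)]).re -
        (S.1 ![H.toVC x, H.toVC (H.J₂ y), H.toVC (H.J₂ z), H.toVC w]).re :=
  H.curvOf_apply S.1 x y z w

/-- The inverse of `𝒦`: on `V`, `S` is recovered from `K = 𝒦(S)` by
`S(x, y, z, w) = ½ (K(x, J₂ y, z, J₂ w) - K(x, J₃ y, z, J₃ w))`. -/
theorem 𝒦_inverse (H : HyperHermitian W) (S : H.symTensors) (x y z w : W) :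
    S.1 ![H.toVC x, H.toVC y, H.toVC z, H.toVC w] =
      ((1 / 2 * ((H.𝒦 S).1 ![x, H.J₂ y, z, H.J₂ w] - (H.𝒦 S).1 ![x, H.J₃ y, z, H.J₃ w]) : ℝ) :
        ℂ) := by
  obtain ⟨s, hs, s01, s12, s23, sJ, sn, sI⟩ := H.symTensors_vec S.2
  have jj : ∀ x, H.J₂ (H.J₂ x) = -x := fun x => H.j_j x
  have j3 : ∀ x, H.J₂ (H.J₃ x) = H.J₁ x := by
    intro x; simp [H.j.map_smulₛₗ, H.j_j]
  have j3' : ∀ x, H.J₃ x = H.J₁ (H.J₂ x) := fun _ => rfl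
  have sn1 : ∀ x y z w, s x (-y) z w = -s x y z w := by
    intro x y z w; rw [s01, sn, s01]
  have sn3 : ∀ x y z w, s x y z (-w) = -s x y z w := by
    intro x y z w; rw [s23, s12, sn1, s12, s23]
  have sI' : ∀ x y z w, s x (H.J₁ y) z (H.J₁ w) = -s x y z w := by
    intro x y z w; rw [s12, sI, s12]
  simp only [𝒦_apply, hs, Complex.ofReal_re, jj, j3, sn1, sn3, sI']
  simp only [j3', sI']
  congr 1
  ring

theorem 𝒦_injective (H : HyperHermitian W) : Function.Injective H.𝒦 := by
  intro S S' h
  refine Subtype.ext ?_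
  refine Module.Basis.ext_multilinear
    (fun _ => Algebra.TensorProduct.basis ℂ (Module.Basis.ofVectorSpace ℝ W)) fun v => ?_
  have : ∀ f : Fin 4 → W, S.1 (fun k => H.toVC (f k)) = S'.1 (fun k => H.toVC (f k)) := by
    intro f
    rw [fun_eq_vec (fun k => H.toVC (f k)), 𝒦_inverse, 𝒦_inverse, h]
  simpa only [toVC, TensorProduct.mk_apply, Algebra.TensorProduct.basis_apply] using
    this fun k => Module.Basis.ofVectorSpace ℝ W (v k)

/-! ### The Lie algebra `sp(n)` and the operator `𝒯_K` -/

theorem g_symm (H : HyperHermitian W) (x y : W) : H.g x y = H.g y x := by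
  have hs : ∀ a b, H.π a b = -H.π b a := by
    intro a b
    have := H.π_self (a + b)
    simp only [map_add, LinearMap.add_apply, H.π_self, zero_add, add_zero] at this
    exact eq_neg_of_add_eq_zero_right this
  have h := H.π_j_j (H.j x) y
  rw [H.j_j, map_neg, LinearMap.neg_apply] at h
  rw [g_apply, g_apply, hs y, Complex.neg_re, ← Complex.conj_re (H.π (H.j x) y), ← h, Complex.neg_re, neg_neg]

theorem g_pos (H : HyperHermitian W) (x : W) (hx : x ≠ 0) : 0 < H.g x x := by
  have := (Complex.lt_def.mp (H.π_pos x hx)).1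
  rw [g_apply]
  simp only [Complex.zero_re] at this
  linarith

theorem g_J (H : HyperHermitian W) (k : Fin 3) (x y : W) :
    H.g (H.J k x) (H.J k y) = H.g x y := by
  have h1 : ∀ x y, H.g (H.J₁ x) (H.J₁ y) = H.g x y := by
    intro x y
    simp only [g_apply, J₁_apply, H.j.map_smulₛₗ, map_smul, LinearMap.smul_apply, smul_eq_mul,
      Complex.conj_I, ← mul_assoc]
    simp
  have h2 : ∀ x y, H.g (H.J₂ x) (H.J₂ y) = H.g x y := by
    intro x y
    rw [g_apply, J₂_apply, J₂_apply, H.π_j_j, Complex.conj_re, g_apply]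
  fin_cases k
  · exact h1 x y
  · exact h2 x y
  · exact (h1 (H.J₂ x) (H.J₂ y)).trans (h2 x y)

theorem J_J (H : HyperHermitian W) (k : Fin 3) (x : W) : H.J k (H.J k x) = -x := by
  fin_cases k
  · exact H.J₁_J₁ x
  · exact H.j_j x
  · change Complex.I • H.j (Complex.I • H.j x) = -x
    simp [H.j.map_smulₛₗ, H.j_j, smul_smul]

/-- The Lie algebra `sp(n)` of all endomorphisms `A` of `V` with `g(Ax, y) + g(x, Ay) = 0` and
`A J_s = J_s A` for `s = 1, 2, 3`, with the commutator as the bracket. -/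
def sp (H : HyperHermitian W) : LieSubalgebra ℝ (Module.End ℝ W) where
  carrier := {A | (∀ x y, H.g (A x) y + H.g x (A y) = 0) ∧ ∀ k, A * H.J k = H.J k * A}
  zero_mem' := by simp
  add_mem' := by
    rintro A B ⟨h1, h2⟩ ⟨k1, k2⟩
    refine ⟨fun x y => ?_, fun k => ?_⟩
    · simp only [LinearMap.add_apply, map_add]
      linarith [h1 x y, k1 x y]
    · rw [add_mul, mul_add, h2, k2]
  smul_mem' := by
    rintro c A ⟨h1, h2⟩
    refine ⟨fun x y => ?_, fun k => ?_⟩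
    · simp only [LinearMap.smul_apply, map_smul, smul_eq_mul]
      rw [← mul_add, h1, mul_zero]
    · rw [smul_mul_assoc, mul_smul_comm, h2]
  lie_mem' := by
    rintro A B ⟨h1, h2⟩ ⟨k1, k2⟩
    refine ⟨fun x y => ?_, fun k => ?_⟩
    · simp only [Ring.lie_def, LinearMap.sub_apply, Module.End.mul_apply, map_sub]
      linarith [h1 (B x) y, h1 x (B y), k1 (A x) y, k1 x (A y)]
    · rw [Ring.lie_def, sub_mul, mul_sub, mul_assoc, k2, ← mul_assoc, h2, mul_assoc, mul_assoc B,
        h2, ← mul_assoc B, k2, mul_assoc]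

/-- The basis `h` of `V` is orthonormal for `g`. -/
def IsOrthonormalBasis (H : HyperHermitian W) {κ : Type*} (h : Module.Basis κ ℝ W) : Prop :=
  (∀ a, H.g (h a) (h a) = 1) ∧ ∀ a b, a ≠ b → H.g (h a) (h b) = 0

theorem exists_orthonormalBasis (H : HyperHermitian W) [FiniteDimensional ℂ W] :
    ∃ h : Module.Basis (Fin (Module.finrank ℝ W)) ℝ W, H.IsOrthonormalBasis h := by
  have : FiniteDimensional ℝ W := FiniteDimensional.complexToReal W
  let c : InnerProductSpace.Core ℝ W :=
    { inner := fun x y => H.g x y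
      conj_inner_symm := fun x y => H.g_symm y x
      re_inner_nonneg := fun x => by
        by_cases hx : x = 0
        · simp [hx]
        · exact (H.g_pos x hx).le
      add_left := fun x y z => by simp
      smul_left := fun x y r => by simp
      definite := fun x hx => by
        by_contra h
        exact (H.g_pos x h).ne' hx }
  let _ : NormedAddCommGroup W := c.toNormedAddCommGroup
  let _ : InnerProductSpace ℝ W := InnerProductSpace.ofCore c.toCore
  let h := stdOrthonormalBasis ℝ W
  refine ⟨h.toBasis, fun a => ?_, fun a b hab => ?_⟩
  · have := h.orthonormal.1 a
    have h2 := real_inner_self_eq_norm_sq (h a)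
    rw [this] at h2
    rw [h.coe_toBasis]
    exact h2.trans (by norm_num)
  · rw [h.coe_toBasis]
    exact h.orthonormal.2 hab

/-- A `g`-orthonormal basis of `V`. -/
def onb (H : HyperHermitian W) [FiniteDimensional ℂ W] :
    Module.Basis (Fin (Module.finrank ℝ W)) ℝ W := H.exists_orthonormalBasis.choose

theorem onb_spec (H : HyperHermitian W) [FiniteDimensional ℂ W] : H.IsOrthonormalBasis H.onb :=
  H.exists_orthonormalBasis.choose_spec

/-- A vector is determined by its inner products with all vectors. -/
theorem g_ext (H : HyperHermitian W) {x y : W} (h : ∀ z, H.g x z = H.g y z) : x = y := by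
  by_contra hxy
  have := H.g_pos (x - y) (sub_ne_zero.mpr hxy)
  rw [H.g.map_sub, LinearMap.sub_apply, h, sub_self] at this
  exact this.false

theorem g_sum (H : HyperHermitian W) {κ : Type*} [Fintype κ] {h : Module.Basis κ ℝ W}
    (hh : H.IsOrthonormalBasis h) (f : W →ₗ[ℝ] ℝ) (y : W) :
    H.g (∑ b, f (h b) • h b) y = f y := by
  classical
  suffices e : H.g (∑ b, f (h b) • h b) = f by rw [e]
  refine h.ext fun a => ?_
  simp only [map_sum, map_smul, LinearMap.sum_apply, LinearMap.smul_apply, smul_eq_mul]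
  rw [Finset.sum_eq_single a]
  · rw [hh.1, mul_one]
  · intro b _ hb
    rw [hh.2 b a hb, mul_zero]
  · simp

theorem g_expand (H : HyperHermitian W) {κ : Type*} [Fintype κ] {h : Module.Basis κ ℝ W}
    (hh : H.IsOrthonormalBasis h) (z : W) : z = ∑ b, H.g z (h b) • h b :=
  H.g_ext fun t => (H.g_sum hh (H.g z) t).symm

/-- The real number `½ ∑ₐ K(x, y, hₐ, A hₐ)`. -/
def contr (_H : HyperHermitian W) {κ : Type*} [Fintype κ] (h : Module.Basis κ ℝ W)
    (K : MultilinearMap ℝ (fun _ : Fin 4 => W) ℝ) (A : Module.End ℝ W) (x y : W) : ℝ :=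
  (1 / 2) * ∑ a, K ![x, y, h a, A (h a)]

/-- `contr` as a bilinear map in `x` and `y`. -/
def contrₗ (H : HyperHermitian W) {κ : Type*} [Fintype κ] (h : Module.Basis κ ℝ W)
    (K : MultilinearMap ℝ (fun _ : Fin 4 => W) ℝ) (A : Module.End ℝ W) :
    W →ₗ[ℝ] W →ₗ[ℝ] ℝ :=
  LinearMap.mk₂ ℝ (H.contr h K A)
    (by
      intro x x' y
      have : ∀ z w, K ![x + x', y, z, w] = K ![x, y, z, w] + K ![x', y, z, w] := fun z w =>
        K.cons_add ![y, z, w] x x'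
      simp only [contr, this, Finset.sum_add_distrib, mul_add])
    (by
      intro c x y
      have : ∀ z w, K ![c • x, y, z, w] = c * K ![x, y, z, w] := fun z w =>
        K.cons_smul ![y, z, w] c x
      simp only [contr, this, ← Finset.mul_sum, smul_eq_mul]
      ring)
    (by
      intro x y y'
      have u : ∀ y z w t : W, Function.update ![x, y, z, w] 1 t = ![x, t, z, w] := by
        intro y z w t; funext k; fin_cases k <;> rfl
      have : ∀ z w, K ![x, y + y', z, w] = K ![x, y, z, w] + K ![x, y', z, w] := by
        intro z w
        simpa only [u] using K.map_update_add ![x, y, z, w] 1 y y'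
      simp only [contr, this, Finset.sum_add_distrib, mul_add])
    (by
      intro c x y
      have u : ∀ y z w t : W, Function.update ![x, y, z, w] 1 t = ![x, t, z, w] := by
        intro y z w t; funext k; fin_cases k <;> rfl
      have : ∀ z w, K ![x, c • y, z, w] = c * K ![x, y, z, w] := by
        intro z w
        simpa only [u, smul_eq_mul] using K.map_update_smul ![x, y, z, w] 1 c y
      simp only [contr, this, ← Finset.mul_sum, smul_eq_mul]
      ring)

theorem contr_add (H : HyperHermitian W) {κ : Type*} [Fintype κ] (h : Module.Basis κ ℝ W)
    (K : MultilinearMap ℝ (fun _ : Fin 4 => W) ℝ) (A B : Module.End ℝ W) (x y : W) :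
    H.contr h K (A + B) x y = H.contr h K A x y + H.contr h K B x y := by
  have u : ∀ z w t : W, Function.update ![x, y, z, w] 3 t = ![x, y, z, t] := by
    intro z w t; funext k; fin_cases k <;> rfl
  have : ∀ z w w', K ![x, y, z, w + w'] = K ![x, y, z, w] + K ![x, y, z, w'] := by
    intro z w w'
    simpa only [u] using K.map_update_add ![x, y, z, w] 3 w w'
  simp only [contr, LinearMap.add_apply, this, Finset.sum_add_distrib, mul_add]

theorem contr_smul (H : HyperHermitian W) {κ : Type*} [Fintype κ] (h : Module.Basis κ ℝ W)
    (K : MultilinearMap ℝ (fun _ : Fin 4 => W) ℝ) (c : ℝ) (A : Module.End ℝ W) (x y : W) :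
    H.contr h K (c • A) x y = c * H.contr h K A x y := by
  have u : ∀ z w t : W, Function.update ![x, y, z, w] 3 t = ![x, y, z, t] := by
    intro z w t; funext k; fin_cases k <;> rfl
  have : ∀ z w, K ![x, y, z, c • w] = c * K ![x, y, z, w] := by
    intro z w
    simpa only [u, smul_eq_mul] using K.map_update_smul ![x, y, z, w] 3 c w
  simp only [contr, LinearMap.smul_apply, this, ← Finset.mul_sum]
  ring

/-- A curvature-type tensor is also invariant under `J_s` in its first two arguments. -/
theorem curvTensors_J (H : HyperHermitian W) {K} (hK : K ∈ H.curvTensors) (k : Fin 3)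
    (x y z w : W) : K ![H.J k x, H.J k y, z, w] = K ![x, y, z, w] := by
  obtain ⟨h1, h2, h3, h4⟩ := hK
  have pair : ∀ x y z w, K ![x, y, z, w] = K ![z, w, x, y] := by
    intro x y z w
    linarith [h3 x y z w, h3 y z w x, h3 z w x y, h3 w x y z,
      h1 x y z w, h1 x y w z, h1 y z x w, h1 z w x y, h1 w x y z, h1 z x y w, h1 w y z x,
      h2 x y z w, h2 y z x w, h2 z w x y, h2 w x y z, h2 z x y w, h2 w y z x,
      h1 y w z x, h2 y w z x, h1 x z w y, h2 x z w y, h1 x z y w, h2 x z y w, h1 y w x z,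
      h2 y w x z, h1 x w y z, h2 x w y z, h1 z y w x, h2 z y w x]
  rw [pair, h4, pair]

/-- The vector `𝒯_K(A) x`, i.e. the vector whose inner product with every `y` is
`½ ∑ₐ K(x, y, hₐ, A hₐ)`. -/
def opFun (H : HyperHermitian W) [FiniteDimensional ℂ W]
    (K : MultilinearMap ℝ (fun _ : Fin 4 => W) ℝ) (A : Module.End ℝ W) (x : W) : W :=
  ∑ b, H.contr H.onb K A x (H.onb b) • H.onb b

theorem g_opFun (H : HyperHermitian W) [FiniteDimensional ℂ W]
    (K : MultilinearMap ℝ (fun _ : Fin 4 => W) ℝ) (A : Module.End ℝ W) (x y : W) :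
    H.g (H.opFun K A x) y = H.contr H.onb K A x y :=
  H.g_sum H.onb_spec (H.contrₗ H.onb K A x) y

/-- The operator `𝒯_K : sp(n) → sp(n)` of a curvature-type tensor `K`, determined by
`g(𝒯_K(A) x, y) = ½ ∑ₐ K(x, y, hₐ, A hₐ)`, where `h` is an orthonormal basis of `V`. -/
def 𝒯 (H : HyperHermitian W) [FiniteDimensional ℂ W] (K : H.curvTensors) :
    H.sp →ₗ[ℝ] H.sp where
  toFun A :=
    ⟨{ toFun := H.opFun K.1 A.1
       map_add' := fun x x' => H.g_ext fun y => by
        rw [map_add, LinearMap.add_apply, g_opFun, g_opFun, g_opFun]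
        exact congrArg (fun f => f y) ((H.contrₗ H.onb K.1 A.1).map_add x x')
       map_smul' := fun c x => H.g_ext fun y => by
        rw [RingHom.id_apply, map_smul, LinearMap.smul_apply, g_opFun, g_opFun]
        exact congrArg (fun f => f y) ((H.contrₗ H.onb K.1 A.1).map_smul c x) }, by
      refine ⟨fun x y => ?_, fun k => ?_⟩
      · rw [H.g_symm x]
        change H.g (H.opFun K.1 A.1 x) y + H.g (H.opFun K.1 A.1 y) x = 0
        rw [g_opFun, g_opFun, contr, contr]
        simp only [K.2.1 y x, Finset.sum_neg_distrib]
        ring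
      · refine LinearMap.ext fun x => H.g_ext fun y => ?_
        change H.g (H.opFun K.1 A.1 (H.J k x)) y = H.g (H.J k (H.opFun K.1 A.1 x)) y
        obtain ⟨y, rfl⟩ : ∃ y', H.J k y' = y := ⟨-H.J k y, by rw [map_neg, J_J, neg_neg]⟩
        rw [g_J, g_opFun, g_opFun, contr, contr]
        simp only [H.curvTensors_J K.2]⟩
  map_add' A B := Subtype.ext <| LinearMap.ext fun x => H.g_ext fun y => by
    change H.g (H.opFun K.1 (A.1 + B.1) x) y = H.g (H.opFun K.1 A.1 x + H.opFun K.1 B.1 x) y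
    rw [map_add, LinearMap.add_apply, g_opFun, g_opFun, g_opFun, contr_add]
  map_smul' c A := Subtype.ext <| LinearMap.ext fun x => H.g_ext fun y => by
    change H.g (H.opFun K.1 (c • A.1) x) y = H.g (c • H.opFun K.1 A.1 x) y
    rw [map_smul, LinearMap.smul_apply, g_opFun, g_opFun, contr_smul, smul_eq_mul]

/-- The defining equation of `𝒯_K`, for an arbitrary orthonormal basis `h` of `V`. -/
theorem g_𝒯 (H : HyperHermitian W) [FiniteDimensional ℂ W] (K : H.curvTensors) {κ : Type*}
    [Fintype κ] {h : Module.Basis κ ℝ W} (hh : H.IsOrthonormalBasis h) (A : H.sp) (x y : W) :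
    H.g ((H.𝒯 K A).1 x) y = (1 / 2) * ∑ a, K.1 ![x, y, h a, A.1 (h a)] := by
  classical
  have u2 : ∀ z w t : W, Function.update ![x, y, z, w] 2 t = ![x, y, t, w] := by
    intro z w t; funext k; fin_cases k <;> rfl
  have u3 : ∀ z w t : W, Function.update ![x, y, z, w] 3 t = ![x, y, z, t] := by
    intro z w t; funext k; fin_cases k <;> rfl
  let F : W →ₗ[ℝ] W →ₗ[ℝ] ℝ := LinearMap.mk₂ ℝ (fun z w => K.1 ![x, y, z, A.1 w])
    (by intro z z' w; simpa only [u2] using K.1.map_update_add ![x, y, z, A.1 w] 2 z z')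
    (by intro c z w; simpa only [u2] using K.1.map_update_smul ![x, y, z, A.1 w] 2 c z)
    (by
      intro z w w'
      simpa only [u3, map_add] using K.1.map_update_add ![x, y, z, A.1 w] 3 (A.1 w) (A.1 w'))
    (by
      intro c z w
      simpa only [u3, map_smul] using K.1.map_update_smul ![x, y, z, A.1 w] 3 c (A.1 w))
  have key : ∑ a, F (H.onb a) (H.onb a) = ∑ a, F (h a) (h a) := by
    calc ∑ a, F (H.onb a) (H.onb a)
        = ∑ a, ∑ b, H.g (H.onb a) (h b) * F (H.onb a) (h b) := by
          refine Finset.sum_congr rfl fun a _ => ?_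
          refine (congrArg (F (H.onb a)) (H.g_expand hh (H.onb a))).trans ?_
          simp only [map_sum, map_smul, smul_eq_mul]
      _ = ∑ b, ∑ a, H.g (h b) (H.onb a) * F (H.onb a) (h b) := by
          rw [Finset.sum_comm]
          simp only [H.g_symm]
      _ = ∑ b, F (h b) (h b) := by
          refine Finset.sum_congr rfl fun b _ => ?_
          refine Eq.symm ((congrArg (fun t => F t (h b)) (H.g_expand H.onb_spec (h b))).trans ?_)
          simp only [map_sum, map_smul, smul_eq_mul, LinearMap.sum_apply, LinearMap.smul_apply]
  exact (H.g_opFun K.1 A.1 x y).trans (congrArg (fun t => (1 / 2) * t) key)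

/-- The operator `P = (1/5) 𝒯_K + (3/10) Id` on `sp(2)`. -/
def P (H : HyperHermitian W) [FiniteDimensional ℂ W] (K : H.curvTensors) : H.sp →ₗ[ℝ] H.sp :=
  (1 / 5 : ℝ) • H.𝒯 K + (3 / 10 : ℝ) • LinearMap.id

/-! ### Adapted bases, components, and the set `𝒞`

Indices run from `0` to `3` instead of from `1` to `4`. -/

/-- `Sp(2)`-adapted bases: `e₃ = j e₁`, `e₄ = j e₂` and `π = e¹ ∧ e³ + e² ∧ e⁴`, where
`e¹, …, e⁴` is the dual basis. -/
def IsAdapted (H : HyperHermitian W) (e : Module.Basis (Fin 4) ℂ W) : Prop :=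
  e 2 = H.j (e 0) ∧ e 3 = H.j (e 1) ∧
    ∀ x y, H.π x y = (e.coord 0 x * e.coord 2 y - e.coord 2 x * e.coord 0 y) +
      (e.coord 1 x * e.coord 3 y - e.coord 3 x * e.coord 1 y)

/-- The components `S_{αβγδ} = S(e_α, e_β, e_γ, e_δ)`. -/
def comp (H : HyperHermitian W) (e : Module.Basis (Fin 4) ℂ W) (S : H.symTensors)
    (α β γ δ : Fin 4) : ℂ :=
  S.1 ![H.ι (e α), H.ι (e β), H.ι (e γ), H.ι (e δ)]

/-- The components `π_{αβ} = π(e_α, e_β)`. -/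
def πLow (H : HyperHermitian W) (e : Module.Basis (Fin 4) ℂ W) (α β : Fin 4) : ℂ :=
  H.π (e α) (e β)

/-- The components `g_{α \bar β} = g(e_α, conj e_β) = π(e_α, j e_β)` of the complexified metric. -/
def gLow (H : HyperHermitian W) (e : Module.Basis (Fin 4) ℂ W) : Matrix (Fin 4) (Fin 4) ℂ :=
  Matrix.of fun α β => H.π (e α) (H.j (e β))

/-- The components `g^{α \bar β}` of the inverse metric: `∑_β g^{α \bar β} g_{γ \bar β}` is `1`
if `α = γ` and `0` otherwise. -/
def gUp (H : HyperHermitian W) (e : Module.Basis (Fin 4) ℂ W) : Matrix (Fin 4) (Fin 4) ℂ :=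
  ((H.gLow e)⁻¹).transpose

/-- The components `π^{αβ} = g^{α \bar σ} g^{β \bar τ} π_{\bar σ \bar τ}` of `π` with both indices
raised by the metric, where `π_{\bar σ \bar τ} = conj π_{στ}`. -/
def πUp (H : HyperHermitian W) (e : Module.Basis (Fin 4) ℂ W) (α β : Fin 4) : ℂ :=
  ∑ σ, ∑ τ, H.gUp e α σ * H.gUp e β τ * starRingEnd ℂ (H.πLow e σ τ)

/-- The discriminant of a cubic polynomial, in coordinates belonging to an adapted basis. -/
def disc (x : Fin 4 → ℂ) : ℂ :=
  -18 * x 0 * x 1 * x 2 * x 3 + 4 * (√3 : ℝ) * x 0 * x 3 ^ 3 - 4 * (√3 : ℝ) * x 1 ^ 3 * x 2 +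
    3 * x 1 ^ 2 * x 3 ^ 2 - 9 * x 0 ^ 2 * x 2 ^ 2

/-- The set `𝒞` of all `K ∈ ℜ^{Sp(2)}` such that the tensor `S ∈ 𝔖^{Sp(2)}` with `𝒦(S) = K` is,
with respect to some adapted basis of `W`, given by the discriminant of a cubic polynomial. -/
def 𝒞 (H : HyperHermitian W) : Set H.curvTensors :=
  {K | ∃ S : H.symTensors, H.𝒦 S = K ∧ ∃ e : Module.Basis (Fin 4) ℂ W, H.IsAdapted e ∧
    ∀ x : W, S.1 ![H.ι x, H.ι x, H.ι x, H.ι x] = disc (e.repr x)}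

/-- The quadratic identity (I) for the components of `S`. -/
def CondI (H : HyperHermitian W) (e : Module.Basis (Fin 4) ℂ W) (S : H.symTensors) : Prop :=
  ∀ α β γ δ : Fin 4,
    ∑ σ, ∑ τ, ∑ μ, ∑ ν,
        H.πUp e σ τ * H.πUp e μ ν * H.comp e S σ μ α β * H.comp e S τ ν γ δ =
      2 * H.comp e S α β γ δ +
        21 / 8 * (H.πLow e α γ * H.πLow e β δ + H.πLow e α δ * H.πLow e β γ)

/-- The quadratic identity (II) for the components of `S`. -/
def CondII (H : HyperHermitian W) (e : Module.Basis (Fin 4) ℂ W) (S : H.symTensors) : Prop :=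
  ∀ (μ ν : Fin 4) (x : Fin 4 → ℂ),
    ∑ α, ∑ β, ∑ γ, ∑ δ,
      ((∑ σ, ∑ τ, H.πUp e σ τ * H.comp e S σ α β γ * H.comp e S τ δ μ ν) +
        3 / 4 * H.comp e S α β γ μ * H.πLow e ν δ +
        3 / 4 * H.comp e S α β γ ν * H.πLow e μ δ) * x α * x β * x γ * x δ = 0

end

end HyperHermitian

/-!
The tensor `S` is determined by its restriction to `W`, a quartic form `form S` with
`form S (j x) (j y) (j z) (j w) = conj (form S x y z w)`. The complexification of `sp(2)` is
`S²(W)`: the product of `u` and `v` acts as `symEnd u v : x ↦ π(u, x) v + π(v, x) u`, and a complex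
linear map vanishes on `sp(2)` if and only if it vanishes on all `symEnd u v`
(`map_symEnd_eq_zero`, `map_cEnd_eq_zero`). On `S²(W)` the operator `𝒯` is contraction with `S`:
`π(𝒯(symEnd u v) x, y) = 2 S(x, y, u, v)` (`cEnd_𝒯`, `π_opC_symEnd`).

Hence condition (I) says that `𝒯² = 2 𝒯 + 21/4`, which is `P² = P` (`condI_iff`). Condition (II)
says that the derivation `P A` annihilates the quartic form, for all `A` (`condII_iff_P`). As the
commutator with `𝒯` of the derivation `D` is `𝒯` formed with the derivative of `S` along `D`, this
is `[P A, 𝒯 B] = 𝒯 [P A, B]` for all `A, B` (`lie_𝒯_iff`), i.e. the bracket identity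
(`condII_iff`). In particular both conditions do not depend on the adapted basis.

For the discriminant the conditions are polynomial identities, after polarization
(`condI_of_disc`, `condII_of_disc`). Conversely, let (I) and (II) hold. Then `P ≠ 0`, and an element
`D ≠ 0` of its range satisfies `𝒯 D = 7/2 D` and annihilates `S`. In an adapted basis that
diagonalizes `D`, with eigenvalues `i l, i m, -i l, -i m` and `l ≥ m ≥ 0`, only the components of
`S` of weight zero survive. The equations `𝒯 D = 7/2 D` and (I) exclude `m = 0` and `l ≠ 3 m`; in
the case `l = m` an idempotent `3 × 3` matrix of trace `1/5` would arise (`ne_of_conditions`). For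
`l = 3 m`, the weights of the irreducible four-dimensional representation of `su(2)`, they
determine the components up to the phase of `S(e 0, e 3, e 3, e 3)` (`components`), which a
rotation of `e 0` removes. So `S` is the discriminant (`mem_𝒞_of_conditions`).
-/

namespace HyperHermitian

noncomputable section

variable {W : Type*} [AddCommGroup W] [Module ℂ W]
variable {H : HyperHermitian W} {e : Module.Basis (Fin 4) ℂ W}

/-! ### The quartic form on `W` of a tensor in `𝔖` -/

/-- The identification `ι` of `W` with the `i`-eigenspace of `J₁` is complex linear. -/
def ιHom (H : HyperHermitian W) : W →ₗ[ℂ] ℂ ⊗[ℝ] W where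
  toFun := H.ι
  map_add' x y := by
    simp only [ι, map_add, TensorProduct.tmul_add]
    abel
  map_smul' c x := by
    have key : ∀ (d : ℂ) (r : ℝ) (y : W), d ⊗ₜ[ℝ] ((r : ℂ) • y) = ((r : ℂ) * d) ⊗ₜ[ℝ] y := by
      intro d r y
      have : ((r : ℂ) • y) = r • y := algebraMap_smul ℂ r y
      rw [this, TensorProduct.tmul_smul, TensorProduct.smul_tmul']
      congr 1
    have hc : c • x = (c.re : ℂ) • x + (c.im : ℂ) • H.J₁ x := by
      rw [J₁_apply, smul_smul, ← add_smul, Complex.re_add_im]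
    have hc' : H.J₁ (c • x) = (c.re : ℂ) • H.J₁ x + (c.im : ℂ) • -x := by
      have e : -x = (Complex.I * Complex.I) • x := by rw [Complex.I_mul_I, neg_one_smul]
      rw [e, J₁_apply, J₁_apply, smul_smul, smul_smul, smul_smul, ← add_smul]
      congr 1
      nth_rewrite 1 [← Complex.re_add_im c]
      ring
    simp only [ι, hc', RingHom.id_apply]
    rw [hc]
    simp only [TensorProduct.tmul_add, key, smul_sub, TensorProduct.smul_tmul', smul_eq_mul]
    have e1 : c * (1 / 2) = (c.re : ℂ) * (1 / 2) + (c.im : ℂ) * (Complex.I / 2) := by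
      nth_rewrite 1 [← Complex.re_add_im c]
      ring
    have e2 : c * (Complex.I / 2) = (c.re : ℂ) * (Complex.I / 2) + -((c.im : ℂ) * (1 / 2)) := by
      nth_rewrite 1 [← Complex.re_add_im c]
      linear_combination (c.im : ℂ) / 2 * Complex.I_mul_I
    rw [e1, e2, TensorProduct.add_tmul, TensorProduct.add_tmul, TensorProduct.neg_tmul,
      TensorProduct.tmul_neg]
    abel

/-- The quartic form of `S ∈ 𝔖`, i.e. the restriction of `S` to `W`, as an iterated linear map. -/
def form (H : HyperHermitian W) (S : H.symTensors) :
    W →ₗ[ℂ] W →ₗ[ℂ] W →ₗ[ℂ] W →ₗ[ℂ] ℂ :=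
  have u0 : ∀ x y z w t : ℂ ⊗[ℝ] W, Function.update ![x, y, z, w] 0 t = ![t, y, z, w] := by
    intro x y z w t; funext k; fin_cases k <;> rfl
  have u1 : ∀ x y z w t : ℂ ⊗[ℝ] W, Function.update ![x, y, z, w] 1 t = ![x, t, z, w] := by
    intro x y z w t; funext k; fin_cases k <;> rfl
  have u2 : ∀ x y z w t : ℂ ⊗[ℝ] W, Function.update ![x, y, z, w] 2 t = ![x, y, t, w] := by
    intro x y z w t; funext k; fin_cases k <;> rfl
  have u3 : ∀ x y z w t : ℂ ⊗[ℝ] W, Function.update ![x, y, z, w] 3 t = ![x, y, z, t] := by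
    intro x y z w t; funext k; fin_cases k <;> rfl
  LinearMap.mk₂ ℂ (fun x y => LinearMap.mk₂ ℂ
      (fun z w => S.1 ![H.ιHom x, H.ιHom y, H.ιHom z, H.ιHom w])
      (fun z z' w => by
        simpa only [u2, map_add] using
          S.1.map_update_add ![H.ιHom x, H.ιHom y, H.ιHom z, H.ιHom w] 2 (H.ιHom z) (H.ιHom z'))
      (fun c z w => by
        simpa only [u2, map_smul] using
          S.1.map_update_smul ![H.ιHom x, H.ιHom y, H.ιHom z, H.ιHom w] 2 c (H.ιHom z))
      (fun z w w' => by
        simpa only [u3, map_add] using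
          S.1.map_update_add ![H.ιHom x, H.ιHom y, H.ιHom z, H.ιHom w] 3 (H.ιHom w) (H.ιHom w'))
      (fun c z w => by
        simpa only [u3, map_smul] using
          S.1.map_update_smul ![H.ιHom x, H.ιHom y, H.ιHom z, H.ιHom w] 3 c (H.ιHom w)))
    (fun x x' y => by
      ext z w
      simpa only [u0, map_add, LinearMap.add_apply, LinearMap.mk₂_apply] using
        S.1.map_update_add ![H.ιHom x, H.ιHom y, H.ιHom z, H.ιHom w] 0 (H.ιHom x) (H.ιHom x'))
    (fun c x y => by
      ext z w
      simpa only [u0, map_smul, LinearMap.smul_apply, LinearMap.mk₂_apply] using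
        S.1.map_update_smul ![H.ιHom x, H.ιHom y, H.ιHom z, H.ιHom w] 0 c (H.ιHom x))
    (fun x y y' => by
      ext z w
      simpa only [u1, map_add, LinearMap.add_apply, LinearMap.mk₂_apply] using
        S.1.map_update_add ![H.ιHom x, H.ιHom y, H.ιHom z, H.ιHom w] 1 (H.ιHom y) (H.ιHom y'))
    (fun c x y => by
      ext z w
      simpa only [u1, map_smul, LinearMap.smul_apply, LinearMap.mk₂_apply] using
        S.1.map_update_smul ![H.ιHom x, H.ιHom y, H.ιHom z, H.ιHom w] 1 c (H.ιHom y))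

theorem form_apply (H : HyperHermitian W) (S : H.symTensors) (x y z w : W) :
    H.form S x y z w = S.1 ![H.ι x, H.ι y, H.ι z, H.ι w] := rfl

theorem comp_eq_form (H : HyperHermitian W) (e : Module.Basis (Fin 4) ℂ W) (S : H.symTensors)
    (α β γ δ : Fin 4) : H.comp e S α β γ δ = H.form S (e α) (e β) (e γ) (e δ) := rfl

theorem symTensors_perm (H : HyperHermitian W) (S : H.symTensors) (τ : Equiv.Perm (Fin 4))
    (x y z w : ℂ ⊗[ℝ] W) (v : Fin 4 → ℂ ⊗[ℝ] W) (hv : v = fun k => ![x, y, z, w] (τ k)) :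
    S.1 v = S.1 ![x, y, z, w] := by
  rw [hv, S.2.1]

theorem form_swap01 (H : HyperHermitian W) (S : H.symTensors) (x y z w : W) :
    H.form S x y z w = H.form S y x z w :=
  H.symTensors_perm S (Equiv.swap 0 1) _ _ _ _ _ (by funext k; fin_cases k <;> rfl)

theorem form_swap12 (H : HyperHermitian W) (S : H.symTensors) (x y z w : W) :
    H.form S x y z w = H.form S x z y w :=
  H.symTensors_perm S (Equiv.swap 1 2) _ _ _ _ _ (by funext k; fin_cases k <;> rfl)

theorem form_swap23 (H : HyperHermitian W) (S : H.symTensors) (x y z w : W) :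
    H.form S x y z w = H.form S x y w z :=
  H.symTensors_perm S (Equiv.swap 2 3) _ _ _ _ _ (by funext k; fin_cases k <;> rfl)

theorem conjVC_ι (H : HyperHermitian W) (w : W) :
    H.conjVC (H.ι w) = (1 / 2 : ℂ) ⊗ₜ[ℝ] w + (Complex.I / 2) ⊗ₜ[ℝ] (H.J₁ w) := by
  have h : (starRingEnd ℂ) (Complex.I / 2) = -(Complex.I / 2) := by
    rw [map_div₀, Complex.conj_I, Complex.conj_ofNat]; ring
  have h' : (starRingEnd ℂ) (1 / 2 : ℂ) = 1 / 2 := by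
    rw [map_div₀, map_one, Complex.conj_ofNat]
  simp only [conjVC, ι, map_sub, LinearMap.rTensor_tmul]
  simp only [AlgEquiv.toLinearMap_apply, Complex.conjAe_coe, h, h', TensorProduct.neg_tmul]
  abel

theorem J₂_ι (H : HyperHermitian W) (w : W) :
    H.J₂.baseChange ℂ (H.ι w) = H.conjVC (H.ι (H.j w)) := by
  have e : H.J₂ (H.J₁ w) = -H.J₁ (H.j w) := by simp [H.j.map_smulₛₗ]
  rw [conjVC_ι, ι, map_sub, LinearMap.baseChange_tmul, LinearMap.baseChange_tmul, e,
    TensorProduct.tmul_neg, sub_neg_eq_add, J₂_apply]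

theorem symTensors_conj_ι (H : HyperHermitian W) (S : H.symTensors) (x y z w : W) :
    S.1 ![H.conjVC (H.ι x), H.conjVC (H.ι y), H.conjVC (H.ι z), H.conjVC (H.ι w)] =
      starRingEnd ℂ (H.form S x y z w) := by
  rw [form_apply, S.2.2.2.1]
  exact congrArg S.1
    (fun_eq_vec fun k => H.conjVC (![H.ι x, H.ι y, H.ι z, H.ι w] k)).symm

theorem form_j (H : HyperHermitian W) (S : H.symTensors) (x y z w : W) :
    H.form S (H.j x) (H.j y) (H.j z) (H.j w) = starRingEnd ℂ (H.form S x y z w) := by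
  have h := S.2.2.2.2 ![H.ι x, H.ι y, H.ι z, H.ι w]
  rw [fun_eq_vec (fun k => H.J₂.baseChange ℂ _)] at h
  simp only [Matrix.cons_val, J₂_ι] at h
  rw [symTensors_conj_ι] at h
  rw [form_apply _ _ x, ← h, Complex.conj_conj]

/-- On `V ⊆ V^ℂ` the tensor `S` is twice the real part of its restriction to `W`, as the mixed
components of `S` vanish. -/
theorem symTensors_toVC (H : HyperHermitian W) (S : H.symTensors) (x y z w : W) :
    S.1 ![H.toVC x, H.toVC y, H.toVC z, H.toVC w] = ((2 * (H.form S x y z w).re : ℝ) : ℂ) := by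
  have key : ∀ s : Finset (Fin 4), s ≠ ∅ → s ≠ Finset.univ →
      S.1 (s.piecewise ![H.ι x, H.ι y, H.ι z, H.ι w] fun k =>
        H.conjVC (![H.ι x, H.ι y, H.ι z, H.ι w] k)) = 0 := by
    intro s hs hs'
    have m : ∀ k, ![H.ι x, H.ι y, H.ι z, H.ι w] k ∈ H.W10 := by
      intro k; fin_cases k <;> exact H.ι_mem _
    have m' : ∀ k, H.conjVC (![H.ι x, H.ι y, H.ι z, H.ι w] k) ∈ H.W01 := by
      intro k; fin_cases k <;> exact H.conj_ι_mem _
    obtain ⟨k, hk⟩ := Finset.nonempty_iff_ne_empty.mpr hs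
    obtain ⟨l, hl⟩ : ∃ l, l ∉ s := by
      by_contra! h
      exact hs' (Finset.eq_univ_iff_forall.mpr h)
    refine S.2.2.1 _ ⟨k, ?_⟩ ⟨l, ?_⟩
    · rw [Finset.piecewise_eq_of_mem _ _ _ hk]; exact m k
    · rw [Finset.piecewise_eq_of_notMem _ _ _ hl]; exact m' l
  have e : (![H.toVC x, H.toVC y, H.toVC z, H.toVC w] : Fin 4 → ℂ ⊗[ℝ] W) =
      ![H.ι x, H.ι y, H.ι z, H.ι w] + fun k => H.conjVC (![H.ι x, H.ι y, H.ι z, H.ι w] k) := by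
    funext k; fin_cases k <;> exact H.toVC_eq _
  rw [e, S.1.map_add_univ, Finset.sum_eq_add (∅ : Finset (Fin 4)) Finset.univ
    (by decide) (fun s _ hs => key s hs.1 hs.2) (by simp) (by simp)]
  rw [Finset.piecewise_empty, Finset.piecewise_univ, fun_eq_vec (fun k => H.conjVC _)]
  simp only [Matrix.cons_val]
  rw [symTensors_conj_ι, ← form_apply, add_comm, Complex.add_conj]

theorem 𝒦_form (H : HyperHermitian W) (S : H.symTensors) (x y z w : W) :
    (H.𝒦 S).1 ![x, y, z, w] =
      2 * (H.form S x (H.j y) z (H.j w) - H.form S x (H.j y) (H.j z) w).re := by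
  rw [𝒦_apply, symTensors_toVC, symTensors_toVC, Complex.ofReal_re, Complex.ofReal_re,
    Complex.sub_re, J₂_apply, J₂_apply, J₂_apply, mul_sub]

/-! ### Contractions in an adapted basis -/

theorem π_swap (H : HyperHermitian W) (x y : W) : H.π x y = -H.π y x := by
  have := H.π_self (x + y)
  simp only [map_add, LinearMap.add_apply, H.π_self, zero_add, add_zero] at this
  exact eq_neg_of_add_eq_zero_right this

theorem π_j_left (H : HyperHermitian W) (x y : W) :
    H.π (H.j x) y = -starRingEnd ℂ (H.π x (H.j y)) := by
  rw [← H.π_j_j, H.j_j, map_neg, neg_neg]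

theorem π_ext (H : HyperHermitian W) {x y : W} (h : ∀ z, H.π x z = H.π y z) : x = y :=
  H.g_ext fun z => by rw [g_apply, g_apply, h]

namespace IsAdapted

theorem j0 (he : H.IsAdapted e) : H.j (e 0) = e 2 := he.1.symm
theorem j1 (he : H.IsAdapted e) : H.j (e 1) = e 3 := he.2.1.symm
theorem j2 (he : H.IsAdapted e) : H.j (e 2) = -e 0 := by rw [he.1, H.j_j]
theorem j3 (he : H.IsAdapted e) : H.j (e 3) = -e 1 := by rw [he.2.1, H.j_j]

theorem π_eq (he : H.IsAdapted e) (x y : W) :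
    H.π x y = (e.repr x 0 * e.repr y 2 - e.repr x 2 * e.repr y 0) +
      (e.repr x 1 * e.repr y 3 - e.repr x 3 * e.repr y 1) := he.2.2 x y

/-- The dual basis is `x ↦ π(x, j e_α)`. -/
theorem π_j_eq_repr (he : H.IsAdapted e) (x : W) (α : Fin 4) :
    H.π x (H.j (e α)) = e.repr x α := by
  fin_cases α <;> simp [he.π_eq, he.j0, he.j1, he.j2, he.j3]

theorem sum_π_j_smul (he : H.IsAdapted e) (x : W) : ∑ α, H.π x (H.j (e α)) • e α = x := by
  simp only [he.π_j_eq_repr]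
  exact e.sum_repr x

theorem sum_π_smul_j (he : H.IsAdapted e) (x : W) : ∑ α, H.π (e α) x • H.j (e α) = x := by
  conv_rhs => rw [← he.sum_π_j_smul x]
  simp only [Fin.sum_univ_four, he.j0, he.j1, he.j2, he.j3, LinearMap.neg_apply, map_neg,
    H.π_swap x]
  module

theorem gUp_eq (he : H.IsAdapted e) : H.gUp e = 1 := by
  have : H.gLow e = 1 := by
    ext α β
    rw [gLow, Matrix.of_apply, he.π_j_eq_repr, Matrix.one_apply, e.repr_self,
      Finsupp.single_apply]
  rw [gUp, this, inv_one, Matrix.transpose_one]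

theorem πUp_eq (he : H.IsAdapted e) (α β : Fin 4) : H.πUp e α β = H.πLow e α β := by
  have : starRingEnd ℂ (H.πLow e α β) = H.πLow e α β := by
    fin_cases α <;> fin_cases β <;> simp [πLow, he.π_eq]
  rw [πUp, he.gUp_eq, Finset.sum_eq_single α _ (by simp), Finset.sum_eq_single β _ (by simp)]
  · simp [this]
  · intro b _ hb; simp [Matrix.one_apply_ne hb.symm]
  · intro b _ hb; simp [Matrix.one_apply_ne hb.symm]

/-- Contraction of a bilinear map with `π^{στ}`. -/
theorem sum_πUp_smul (he : H.IsAdapted e) {M : Type*} [AddCommGroup M] [Module ℂ M]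
    (f : W →ₗ[ℂ] W →ₗ[ℂ] M) :
    ∑ σ, ∑ τ, H.πUp e σ τ • f (e σ) (e τ) = ∑ σ, f (e σ) (H.j (e σ)) := by
  simp only [he.πUp_eq]
  refine Finset.sum_congr rfl fun σ _ => ?_
  have h := congrArg (f (e σ)) (he.sum_π_smul_j (H.j (e σ)))
  rw [map_sum] at h
  rw [← h]
  simp only [he.π_j_eq_repr, map_smul, e.repr_self]
  fin_cases σ <;>
    simp [πLow, he.π_eq, he.j0, he.j1, he.j2, he.j3, Finsupp.single_apply]

/-- Contraction with `π` is skew: moving `j` to the other factor changes the sign. -/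
theorem sum_j_swap (he : H.IsAdapted e) {M : Type*} [AddCommGroup M] [Module ℂ M]
    (f : W →ₗ[ℂ] W →ₗ[ℂ] M) :
    ∑ σ, f (e σ) (H.j (e σ)) = -∑ σ, f (H.j (e σ)) (e σ) := by
  simp only [Fin.sum_univ_four, he.j0, he.j1, he.j2, he.j3, map_neg, LinearMap.neg_apply]
  abel

end IsAdapted

/-! ### The complexification of `sp(n)` -/

/-- The endomorphism `x ↦ π(u, x) v + π(v, x) u` of `W`, the element of `sp(n) ⊗ ℂ = S²(W)`
that corresponds to the symmetric product of `u` and `v`. -/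
def symEnd (H : HyperHermitian W) (u v : W) : Module.End ℂ W :=
  (H.π u).smulRight v + (H.π v).smulRight u

theorem symEnd_apply (H : HyperHermitian W) (u v x : W) :
    H.symEnd u v x = H.π u x • v + H.π v x • u := rfl

theorem π_symEnd (H : HyperHermitian W) (u v x y : W) :
    H.π (H.symEnd u v x) y = H.π u x * H.π v y + H.π v x * H.π u y := by
  simp [symEnd_apply]

/-- `symEnd` as a bilinear map. -/
def symEndₗ (H : HyperHermitian W) : W →ₗ[ℂ] W →ₗ[ℂ] Module.End ℂ W :=
  LinearMap.mk₂ ℂ H.symEnd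
    (fun u u' v => by ext x; simp only [symEnd_apply, LinearMap.add_apply, map_add]; module)
    (fun c u v => by
      ext x; simp only [symEnd_apply, LinearMap.smul_apply, map_smul, smul_eq_mul]; module)
    (fun u v v' => by ext x; simp only [symEnd_apply, LinearMap.add_apply, map_add]; module)
    (fun c u v => by
      ext x; simp only [symEnd_apply, LinearMap.smul_apply, map_smul, smul_eq_mul]; module)

theorem sp_J₁ (H : HyperHermitian W) (A : H.sp) (x : W) :
    A.1 (Complex.I • x) = Complex.I • A.1 x :=
  LinearMap.congr_fun (A.2.2 0) x

theorem sp_j (H : HyperHermitian W) (A : H.sp) (x : W) : A.1 (H.j x) = H.j (A.1 x) :=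
  LinearMap.congr_fun (A.2.2 1) x

/-- Elements of `sp(n)` are complex linear. -/
def cEnd (H : HyperHermitian W) (A : H.sp) : Module.End ℂ W where
  toFun := A.1
  map_add' := map_add _
  map_smul' c x := by
    have : ∀ y : W, c • y = c.re • y + c.im • (Complex.I • y) := by
      intro y
      rw [← algebraMap_smul ℂ c.re, ← algebraMap_smul ℂ c.im, smul_smul, ← add_smul]
      exact congrArg (· • y) (Complex.re_add_im c).symm
    rw [RingHom.id_apply, this, this, map_add, map_smul, map_smul, sp_J₁]

theorem cEnd_apply (H : HyperHermitian W) (A : H.sp) (x : W) : H.cEnd A x = A.1 x := rfl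

theorem π_sp (H : HyperHermitian W) (A : H.sp) (x y : W) :
    H.π (A.1 x) y = -H.π x (A.1 y) := by
  -- the real parts agree as `A` is skew for `g`; replacing `x` by `i x` gives the imaginary parts
  have re : ∀ x y, (H.π (A.1 x) y).re = -(H.π x (A.1 y)).re := by
    intro x y
    have h := A.2.1 x (-H.j y)
    rw [g_apply, g_apply, ← sp_j, map_neg, H.j_j, neg_neg] at h
    linarith
  have h := re (Complex.I • x) y
  rw [sp_J₁] at h
  simp only [map_smul, LinearMap.smul_apply, smul_eq_mul, Complex.I_mul_re] at h
  exact Complex.ext (by rw [Complex.neg_re, re]) (by rw [Complex.neg_im]; linarith)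

theorem j_symEnd (H : HyperHermitian W) (u v x : W) :
    H.j (H.symEnd u v x) = H.symEnd (H.j u) (H.j v) (H.j x) := by
  simp only [symEnd_apply, map_add, H.j.map_smulₛₗ, H.π_j_j]

/-- The real part, with respect to the real structure of `sp(n) ⊗ ℂ` given by `j`, of
`2 • symEnd u v`. -/
def spOf (H : HyperHermitian W) (u v : W) : H.sp :=
  ⟨(H.symEnd u v + H.symEnd (H.j u) (H.j v)).restrictScalars ℝ, by
    have hj : ∀ x, H.symEnd u v (H.j x) + H.symEnd (H.j u) (H.j v) (H.j x) =
        H.j (H.symEnd u v x + H.symEnd (H.j u) (H.j v) x) := by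
      intro x
      rw [map_add, j_symEnd, j_symEnd, H.j_j, H.j_j, add_comm]
      simp [symEnd_apply]
    refine ⟨fun x y => ?_, fun k => ?_⟩
    · simp only [g_apply, LinearMap.restrictScalars_apply, LinearMap.add_apply, ← hj]
      simp only [map_add, LinearMap.add_apply, π_symEnd]
      rw [H.π_swap x (H.symEnd _ _ _), H.π_swap x (H.symEnd _ _ _), π_symEnd, π_symEnd]
      simp only [Complex.add_re, Complex.neg_re, mul_comm (H.π _ (H.j y))]
      ring
    · ext x
      fin_cases k
      · exact map_smul (H.symEnd u v + H.symEnd (H.j u) (H.j v)) Complex.I x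
      · exact hj x
      · exact (map_smul (H.symEnd u v + H.symEnd (H.j u) (H.j v)) Complex.I (H.j x)).trans
          (congrArg (Complex.I • ·) (hj x))⟩

theorem cEnd_spOf (H : HyperHermitian W) (u v : W) :
    H.cEnd (H.spOf u v) = H.symEnd u v + H.symEnd (H.j u) (H.j v) := rfl

/-- A complex linear map that vanishes on `sp(n)` vanishes on `sp(n) ⊗ ℂ`. -/
theorem map_symEnd_eq_zero (H : HyperHermitian W) {M : Type*} [AddCommGroup M] [Module ℂ M]
    (φ : Module.End ℂ W →ₗ[ℂ] M) (h : ∀ B : H.sp, φ (H.cEnd B) = 0) (u v : W) :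
    φ (H.symEnd u v) = 0 := by
  -- `symEnd u v` is a complex combination of the real elements `spOf u v` and `spOf (i u) v`
  have h1 := h (H.spOf u v)
  have h2 := h (H.spOf (Complex.I • u) v)
  have e : H.symEnd (Complex.I • u) v + H.symEnd (H.j (Complex.I • u)) (H.j v) =
      Complex.I • (H.symEnd u v - H.symEnd (H.j u) (H.j v)) := by
    ext x
    simp only [symEnd_apply, H.j.map_smulₛₗ, LinearMap.add_apply, LinearMap.sub_apply,
      LinearMap.smul_apply, map_smul, Complex.conj_I, smul_eq_mul]
    module
  rw [cEnd_spOf, map_add] at h1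
  rw [cEnd_spOf, e, map_smul, smul_eq_zero_iff_right Complex.I_ne_zero, map_sub] at h2
  have h3 : (2 : ℂ) • φ (H.symEnd u v) = 0 := by
    rw [two_smul]
    nth_rewrite 1 [eq_neg_of_add_eq_zero_left h1]
    rw [sub_eq_zero.mp h2]
    exact neg_add_cancel _
  exact (smul_eq_zero_iff_right two_ne_zero).mp h3

theorem map_symEnd_eq_zero_of_basis (H : HyperHermitian W) (e : Module.Basis (Fin 4) ℂ W)
    {M : Type*} [AddCommGroup M] [Module ℂ M] (φ : Module.End ℂ W →ₗ[ℂ] M)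
    (h : ∀ α β, φ (H.symEnd (e α) (e β)) = 0) (u v : W) : φ (H.symEnd u v) = 0 := by
  have : H.symEndₗ.compr₂ φ = 0 := LinearMap.ext_basis e e fun α β => h α β
  exact LinearMap.congr_fun₂ this u v

theorem cEnd_eq_sum (H : HyperHermitian W) {e : Module.Basis (Fin 4) ℂ W} (he : H.IsAdapted e)
    (B : H.sp) :
    H.cEnd B = -(1 / 2 : ℂ) • ∑ α, H.symEnd (H.j (e α)) (B.1 (e α)) := by
  ext x
  have h1 : ∑ α, H.π (H.j (e α)) x • B.1 (e α) = -B.1 x := by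
    have := congrArg (H.cEnd B) (he.sum_π_j_smul x)
    simp only [map_sum, map_smul, cEnd_apply] at this
    rw [← this, ← Finset.sum_neg_distrib]
    refine Finset.sum_congr rfl fun α _ => ?_
    rw [H.π_swap, neg_smul]
  have h2 : ∑ α, H.π (B.1 (e α)) x • H.j (e α) = -B.1 x := by
    simp only [π_sp, neg_smul, Finset.sum_neg_distrib, he.sum_π_smul_j]
  simp only [LinearMap.smul_apply, LinearMap.sum_apply, symEnd_apply, Finset.sum_add_distrib,
    h1, h2, cEnd_apply]
  module

theorem map_cEnd_eq_zero (H : HyperHermitian W) {e : Module.Basis (Fin 4) ℂ W}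
    (he : H.IsAdapted e) {M : Type*} [AddCommGroup M] [Module ℂ M]
    (φ : Module.End ℂ W →ₗ[ℂ] M) (h : ∀ u v, φ (H.symEnd u v) = 0) (B : H.sp) :
    φ (H.cEnd B) = 0 := by
  rw [H.cEnd_eq_sum he, map_smul, map_sum, Finset.sum_eq_zero fun α _ => h _ _, smul_zero]

/-! ### The operator `𝒯` on `sp(n) ⊗ ℂ` -/

/-- The complex linear extension of `𝒯_{𝒦(S)}` from `sp(2)` to the endomorphisms of `W`,
written with the help of an adapted basis: `π(𝒯(B) x, y) = -∑_α S(j e_α, B e_α, x, y)`. -/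
def opC (H : HyperHermitian W) (e : Module.Basis (Fin 4) ℂ W) (S : H.symTensors) :
    Module.End ℂ W →ₗ[ℂ] Module.End ℂ W where
  toFun B := -∑ δ, ∑ α,
    (H.form S (H.j (e δ)) (H.j (e α)) (B (e α))).smulRight (e δ)
  map_add' B B' := by
    ext x
    simp only [LinearMap.neg_apply, LinearMap.sum_apply, LinearMap.add_apply, map_add,
      LinearMap.smulRight_apply, add_smul, Finset.sum_add_distrib]
    abel
  map_smul' c B := by
    ext x
    simp only [LinearMap.neg_apply, LinearMap.sum_apply, LinearMap.smul_apply, map_smul,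
      LinearMap.smulRight_apply, smul_assoc, Finset.smul_sum, smul_neg, RingHom.id_apply]

namespace IsAdapted

theorem π_opC (he : H.IsAdapted e) (S : H.symTensors) (B : Module.End ℂ W) (x y : W) :
    H.π (H.opC e S B x) y = -∑ α, H.form S (H.j (e α)) (B (e α)) x y := by
  have h : ∀ α, H.form S (H.j (e α)) (B (e α)) x y =
      ∑ δ, H.form S (H.j (e δ)) (H.j (e α)) (B (e α)) x * H.π (e δ) y := by
    intro α
    conv_lhs => rw [← he.sum_π_smul_j y]
    simp only [map_sum, map_smul, smul_eq_mul]
    refine Finset.sum_congr rfl fun δ _ => ?_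
    rw [mul_comm, H.form_swap23, H.form_swap12, H.form_swap01]
  simp only [h]
  rw [Finset.sum_comm]
  simp only [opC, LinearMap.coe_mk, AddHom.coe_mk, LinearMap.neg_apply, LinearMap.sum_apply,
    LinearMap.smulRight_apply, map_neg, map_sum, map_smul, LinearMap.smul_apply, smul_eq_mul]

theorem π_opC_symEnd (he : H.IsAdapted e) (S : H.symTensors) (u v x y : W) :
    H.π (H.opC e S (H.symEnd u v) x) y = 2 * H.form S x y u v := by
  have h : ∀ u v, ∑ α, H.π u (e α) * H.form S (H.j (e α)) v x y = -H.form S u v x y := by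
    intro u v
    have := congrArg (fun t => H.form S t v x y) (he.sum_π_smul_j u)
    simp only [map_sum, map_smul, LinearMap.sum_apply, LinearMap.smul_apply, smul_eq_mul] at this
    rw [← this, ← Finset.sum_neg_distrib]
    refine Finset.sum_congr rfl fun α _ => ?_
    rw [H.π_swap, neg_mul]
  rw [he.π_opC]
  simp only [symEnd_apply, map_add, map_smul, LinearMap.add_apply, LinearMap.smul_apply,
    smul_eq_mul, Finset.sum_add_distrib, h]
  rw [H.form_swap01 S v u]
  have : H.form S u v x y = H.form S x y u v := by
    rw [H.form_swap12, H.form_swap01, H.form_swap23, H.form_swap12]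
  rw [this]
  ring

/-- The vectors `e_α / √2` and `i e_α / √2` form a `g`-orthonormal basis of `V`. -/
def realBasis (_he : H.IsAdapted e) : Module.Basis (Fin 2 × Fin 4) ℝ W :=
  (Complex.basisOneI.smulTower e).isUnitSMul (w := fun _ => (√2)⁻¹)
    fun _ => IsUnit.mk0 _ (by positivity)

theorem realBasis_zero (he : H.IsAdapted e) (α : Fin 4) :
    he.realBasis (0, α) = (√2)⁻¹ • e α := by
  simp [realBasis, Module.Basis.isUnitSMul_apply]

theorem realBasis_one (he : H.IsAdapted e) (α : Fin 4) :
    he.realBasis (1, α) = (√2)⁻¹ • (Complex.I • e α) := by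
  simp [realBasis, Module.Basis.isUnitSMul_apply]

theorem realBasis_spec (he : H.IsAdapted e) : H.IsOrthonormalBasis he.realBasis := by
  have hs : (√2 : ℝ)⁻¹ * ((√2)⁻¹ * 2) = 1 := by
    have := Real.mul_self_sqrt (show (0 : ℝ) ≤ 2 by norm_num)
    field_simp
    linarith
  have h1 : ∀ x y, H.g (Complex.I • x) (Complex.I • y) = H.g x y := H.g_J 0
  have hd : ∀ α β, H.g (e α) (e β) = if α = β then 2 else 0 := by
    intro α β
    rw [g_apply, he.π_j_eq_repr, e.repr_self, Finsupp.single_apply]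
    split_ifs <;> simp
  have hI : ∀ α β, H.g (Complex.I • e α) (e β) = 0 := by
    intro α β
    rw [g_apply, map_smul, LinearMap.smul_apply, he.π_j_eq_repr, e.repr_self, Finsupp.single_apply]
    split_ifs <;> simp
  constructor
  · rintro ⟨i, α⟩
    fin_cases i
    · simp only [Fin.zero_eta, he.realBasis_zero, map_smul, LinearMap.smul_apply, hd, smul_eq_mul,
        if_true]
      exact hs
    · simp only [Fin.mk_one, he.realBasis_one, map_smul, LinearMap.smul_apply, h1, hd, smul_eq_mul,
        if_true]
      exact hs
  · rintro ⟨i, α⟩ ⟨k, β⟩ hne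
    have hne' : i = k → α ≠ β := by rintro rfl rfl; exact hne rfl
    fin_cases i <;> fin_cases k
    · simp only [Fin.zero_eta, he.realBasis_zero, map_smul, LinearMap.smul_apply, hd, smul_eq_mul,
        if_neg (hne' rfl), mul_zero]
    · simp only [Fin.zero_eta, Fin.mk_one, he.realBasis_zero, he.realBasis_one, map_smul,
        LinearMap.smul_apply, H.g_symm (e α), hI, smul_eq_mul, mul_zero]
    · simp only [Fin.zero_eta, Fin.mk_one, he.realBasis_zero, he.realBasis_one, map_smul,
        LinearMap.smul_apply, hI, smul_eq_mul, mul_zero]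
    · simp only [Fin.mk_one, he.realBasis_one, map_smul, LinearMap.smul_apply, h1, hd, smul_eq_mul,
        if_neg (hne' rfl), mul_zero]

theorem cEnd_𝒯 (he : H.IsAdapted e) [FiniteDimensional ℂ W] (S : H.symTensors) (A : H.sp) :
    H.cEnd (H.𝒯 (H.𝒦 S) A) = H.opC e S (H.cEnd A) := by
  ext x
  refine H.g_ext fun y => ?_
  have hs : (√2 : ℝ)⁻¹ * (√2)⁻¹ = 1 / 2 := by
    rw [← mul_inv, Real.mul_self_sqrt (by norm_num)]
    norm_num
  have u2 : ∀ z w t : W, Function.update ![x, y, z, w] 2 t = ![x, y, t, w] := by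
    intro z w t; funext k; fin_cases k <;> rfl
  have u3 : ∀ z w t : W, Function.update ![x, y, z, w] 3 t = ![x, y, z, t] := by
    intro z w t; funext k; fin_cases k <;> rfl
  have m : ∀ (c : ℝ) (z w : W), (H.𝒦 S).1 ![x, y, c • z, c • w] =
      c * c * (H.𝒦 S).1 ![x, y, z, w] := by
    intro c z w
    have e2 := (H.𝒦 S).1.map_update_smul ![x, y, z, c • w] 2 c z
    have e3 := (H.𝒦 S).1.map_update_smul ![x, y, z, w] 3 c w
    simp only [u2, smul_eq_mul] at e2
    simp only [u3, smul_eq_mul] at e3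
    rw [e2, e3, mul_assoc]
  have hI : ∀ α, (H.𝒦 S).1 ![x, y, Complex.I • e α, Complex.I • A.1 (e α)] =
      (H.𝒦 S).1 ![x, y, e α, A.1 (e α)] := fun α => (H.𝒦 S).2.2.2.2 0 x y _ _
  have hsum : ∑ α, H.form S x (H.j y) (e α) (A.1 (H.j (e α))) =
      -∑ α, H.form S x (H.j y) (H.j (e α)) (A.1 (e α)) := by
    simpa only [LinearMap.compl₂_apply, cEnd_apply] using
      he.sum_j_swap ((H.form S x (H.j y)).compl₂ (H.cEnd A))
  have hform : ∀ z w, H.form S x (H.j y) z w = H.form S z w x (H.j y) := by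
    intro z w
    rw [H.form_swap12, H.form_swap01, H.form_swap23, H.form_swap12]
  rw [cEnd_apply, H.g_𝒯 _ he.realBasis_spec, Fintype.sum_prod_type, Fin.sum_univ_two]
  simp only [he.realBasis_zero, he.realBasis_one, map_smul, m, sp_J₁, hI, hs, ← Finset.mul_sum,
    𝒦_form, ← sp_j]
  rw [g_apply, he.π_opC, ← Complex.re_sum, Finset.sum_sub_distrib, hsum]
  simp only [hform, cEnd_apply, Complex.sub_re, Complex.neg_re]
  ring

end IsAdapted

/-! ### Multilinear preliminaries -/

/-- Polarization: a symmetric quadriadditive form is determined by its values on the diagonal. -/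
theorem eq_zero_of_diagonal {V : Type*} [AddCommGroup V] (f : V → V → V → V → ℂ)
    (add : ∀ x x' y z w, f (x + x') y z w = f x y z w + f x' y z w)
    (s01 : ∀ x y z w, f x y z w = f y x z w) (s12 : ∀ x y z w, f x y z w = f x z y w)
    (s23 : ∀ x y z w, f x y z w = f x y w z) (diag : ∀ x, f x x x x = 0) (x y z w : V) :
    f x y z w = 0 := by
  have a1 : ∀ x y y' z w, f x (y + y') z w = f x y z w + f x y' z w := by
    intro x y y' z w; rw [s01, add, s01 y, s01 y']
  have a2 : ∀ x y z z' w, f x y (z + z') w = f x y z w + f x y z' w := by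
    intro x y z z' w; rw [s12, a1, s12 x z, s12 x z']
  have a3 : ∀ x y z w w', f x y z (w + w') = f x y z w + f x y z w' := by
    intro x y z w w'; rw [s23, a2, s23 x y w, s23 x y w']
  have neg : ∀ x y z w, f (-x) y z w = -f x y z w := fun x y z w =>
    map_neg (AddMonoidHom.mk' (fun t => f t y z w) fun a b => add a b y z w) x
  have n1 : ∀ x y z w, f x (-y) z w = -f x y z w := by
    intro x y z w; rw [s01, neg, s01]
  have n2 : ∀ x y z w, f x y (-z) w = -f x y z w := by
    intro x y z w; rw [s12, n1, s12]
  have n3 : ∀ x y z w, f x y z (-w) = -f x y z w := by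
    intro x y z w; rw [s23, n2, s23]
  have h3 : ∀ x y, f y x x x = 0 := by
    intro x y
    have e1 := diag (x + y)
    have e2 := diag (x + -y)
    have e3 := diag (x + (y + y))
    have r1 : f x y x x = f y x x x := s01 _ _ _ _
    have r2 : f x x y x = f y x x x := (s12 _ _ _ _).trans r1
    have r3 : f x x x y = f y x x x := (s23 _ _ _ _).trans r2
    have t1 : f y x y y = f x y y y := s01 _ _ _ _
    have t2 : f y y x y = f x y y y := (s12 _ _ _ _).trans t1
    have t3 : f y y y x = f x y y y := (s23 _ _ _ _).trans t2
    have u1 : f x y x y = f x x y y := s12 _ _ _ _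
    have u2 : f y x x y = f x x y y := (s01 _ _ _ _).trans u1
    have u3 : f x y y x = f x x y y := (s23 _ _ _ _).trans u1
    have u4 : f y x y x = f x x y y := (s01 _ _ _ _).trans u3
    have u5 : f y y x x = f x x y y := (s12 _ _ _ _).trans u4
    simp only [add, a1, a2, a3, neg, n1, n2, n3, diag, r1, r2, r3, t1, t2, t3, u1, u2, u3, u4,
      u5] at e1 e2 e3
    linear_combination e1 / 4 - e2 / 12 - e3 / 24
  have h2 : ∀ x y z, f y z x x = 0 := by
    intro x y z
    have e1 := h3 (x + z) y
    have e2 := h3 (x + -z) y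
    have r1 : f y x z x = f y z x x := s12 _ _ _ _
    have r2 : f y x x z = f y z x x := (s23 _ _ _ _).trans r1
    have t1 : f y z x z = f y x z z := s12 _ _ _ _
    have t2 : f y z z x = f y x z z := (s23 _ _ _ _).trans t1
    simp only [a1, a2, a3, n1, n2, n3, h3, r1, r2, t1, t2] at e1 e2
    linear_combination (e1 - e2) / 6
  have e := h2 (z + w) x y
  simp only [a2, a3, h2, s23 x y w z] at e
  linear_combination e / 2

/-- A symmetric bilinear form with zero diagonal vanishes. -/
theorem eq_zero_of_diagonal₂ {V : Type*} [AddCommGroup V] (f : V → V → ℂ)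
    (add : ∀ x x' y, f (x + x') y = f x y + f x' y) (s : ∀ x y, f x y = f y x)
    (diag : ∀ x, f x x = 0) (x y : V) : f x y = 0 := by
  have e := diag (x + y)
  rw [add, s x, s y, add, add, diag, diag, s y x] at e
  linear_combination e / 2

/-- The value of a quadrilinear form on the diagonal, in terms of its components. -/
theorem sum_components (e : Module.Basis (Fin 4) ℂ W) (f : W → W → W → W → ℂ)
    (h0 : ∀ y z w, IsLinearMap ℂ fun x => f x y z w)
    (h1 : ∀ x z w, IsLinearMap ℂ fun y => f x y z w)
    (h2 : ∀ x y w, IsLinearMap ℂ fun z => f x y z w)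
    (h3 : ∀ x y z, IsLinearMap ℂ fun w => f x y z w)
    (x : Fin 4 → ℂ) :
    ∑ α, ∑ β, ∑ γ, ∑ δ, f (e α) (e β) (e γ) (e δ) * x α * x β * x γ * x δ =
      f (∑ α, x α • e α) (∑ α, x α • e α) (∑ α, x α • e α) (∑ α, x α • e α) := by
  set X := ∑ α, x α • e α with hX
  have lin : ∀ l : W → ℂ, IsLinearMap ℂ l → ∑ α, x α * l (e α) = l X := by
    intro l hl
    have : l X = hl.mk' l X := rfl
    rw [this, hX, map_sum]
    simp
  have r : ∀ α β γ δ, f (e α) (e β) (e γ) (e δ) * x α * x β * x γ * x δ =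
      x α * (x β * (x γ * (x δ * f (e α) (e β) (e γ) (e δ)))) := by
    intro α β γ δ; ring
  simp only [r, ← Finset.mul_sum]
  simp only [lin _ (h3 _ _ _)]
  simp only [lin _ (h2 _ _ X)]
  simp only [lin _ (h1 _ X X)]
  exact lin _ (h0 X X X)

/-! ### Contractions and derivatives of the quartic form -/

/-- On `sp(n) ⊗ ℂ = S²(W)` the commutator with `D` is the derivation that extends `D`. -/
theorem commutator_symEnd (H : HyperHermitian W) (D : H.sp) (u v : W) :
    H.cEnd D * H.symEnd u v - H.symEnd u v * H.cEnd D =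
      H.symEnd (D.1 u) v + H.symEnd u (D.1 v) := by
  ext x
  simp only [LinearMap.sub_apply, Module.End.mul_apply, LinearMap.add_apply, symEnd_apply, map_add,
    map_smul, cEnd_apply, π_sp]
  module

theorem form_pair_swap (S : H.symTensors) (x y z w : W) :
    H.form S x y z w = H.form S z w x y := by
  rw [H.form_swap12, H.form_swap01, H.form_swap23, H.form_swap12]

/-- The contraction `π^{στ} π^{μν} S_{σμxy} S_{τνzw}`. -/
def quadContr (H : HyperHermitian W) (e : Module.Basis (Fin 4) ℂ W) (S : H.symTensors)
    (x y z w : W) : ℂ :=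
  ∑ σ, ∑ μ, H.form S (e σ) (e μ) x y * H.form S (H.j (e σ)) (H.j (e μ)) z w

/-- The derivative of the quartic form of `S` along `D ∈ sp(n)`, as a symmetric form. -/
def derivForm (S : H.symTensors) (D : H.sp) (x y z w : W) : ℂ :=
  H.form S (D.1 x) y z w + H.form S x (D.1 y) z w + H.form S x y (D.1 z) w +
    H.form S x y z (D.1 w)

theorem derivForm_eq_zero (S : H.symTensors) (D : H.sp)
    (h : ∀ x, H.form S (D.1 x) x x x = 0) (x y z w : W) : derivForm S D x y z w = 0 := by
  refine eq_zero_of_diagonal (derivForm S D) ?_ ?_ ?_ ?_ ?_ x y z w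
  · intro x x' y z w
    simp only [derivForm, map_add, LinearMap.add_apply]
    ring
  · intro x y z w
    rw [derivForm, derivForm, H.form_swap01 S (D.1 x), H.form_swap01 S x (D.1 y),
      H.form_swap01 S x y (D.1 z), H.form_swap01 S x y z (D.1 w)]
    ring
  · intro x y z w
    rw [derivForm, derivForm, H.form_swap12 S (D.1 x), H.form_swap12 S x (D.1 y),
      H.form_swap12 S x y (D.1 z), H.form_swap12 S x y z (D.1 w)]
    ring
  · intro x y z w
    rw [derivForm, derivForm, H.form_swap23 S (D.1 x), H.form_swap23 S x (D.1 y),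
      H.form_swap23 S x y (D.1 z), H.form_swap23 S x y z (D.1 w)]
    ring
  · intro x
    rw [derivForm, H.form_swap23 S x x x (D.1 x), H.form_swap12 S x x (D.1 x) x,
      H.form_swap01 S x (D.1 x) x x, h]
    ring

namespace IsAdapted

/-! ### The first condition -/

theorem sum_πUp_mul (he : H.IsAdapted e) (l m : W →ₗ[ℂ] ℂ) :
    ∑ σ, ∑ τ, H.πUp e σ τ * (l (e σ) * m (e τ)) = ∑ σ, l (e σ) * m (H.j (e σ)) := by
  simpa using he.sum_πUp_smul (l.smulRight m)

theorem condI_iff_quadContr (he : H.IsAdapted e) (S : H.symTensors) :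
    H.CondI e S ↔ ∀ α β γ δ, H.quadContr e S (e α) (e β) (e γ) (e δ) =
      2 * H.form S (e α) (e β) (e γ) (e δ) +
        21 / 8 * (H.π (e α) (e γ) * H.π (e β) (e δ) + H.π (e α) (e δ) * H.π (e β) (e γ)) := by
  have key : ∀ α β γ δ, ∑ σ, ∑ τ, ∑ μ, ∑ ν,
        H.πUp e σ τ * H.πUp e μ ν * H.comp e S σ μ α β * H.comp e S τ ν γ δ =
      H.quadContr e S (e α) (e β) (e γ) (e δ) := by
    intro α β γ δ
    have h1 : ∀ σ τ, ∑ μ, ∑ ν,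
        H.πUp e σ τ * H.πUp e μ ν * H.comp e S σ μ α β * H.comp e S τ ν γ δ =
        ∑ μ, H.πUp e σ τ * ((H.form S (e α) (e β)).flip (e μ) (e σ) *
          (H.form S (e γ) (e δ)).flip (H.j (e μ)) (e τ)) := by
      intro σ τ
      rw [← Finset.mul_sum]
      simp only [LinearMap.flip_apply]
      rw [← he.sum_πUp_mul, Finset.mul_sum]
      simp only [Finset.mul_sum, comp_eq_form, form_pair_swap S (e α) (e β),
        form_pair_swap S (e γ) (e δ)]
      refine Finset.sum_congr rfl fun μ _ => Finset.sum_congr rfl fun ν _ => ?_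
      ring
    simp only [h1]
    have h2 : ∀ σ, ∑ τ, ∑ μ, H.πUp e σ τ * ((H.form S (e α) (e β)).flip (e μ) (e σ) *
          (H.form S (e γ) (e δ)).flip (H.j (e μ)) (e τ)) =
        ∑ μ, ∑ τ, H.πUp e σ τ * ((H.form S (e α) (e β)).flip (e μ) (e σ) *
          (H.form S (e γ) (e δ)).flip (H.j (e μ)) (e τ)) := fun σ => Finset.sum_comm
    simp only [h2]
    rw [Finset.sum_comm]
    simp only [he.sum_πUp_mul]
    rw [Finset.sum_comm]
    simp only [quadContr, LinearMap.flip_apply, form_pair_swap S (e α) (e β),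
        form_pair_swap S (e γ) (e δ)]
  simp only [CondI, key]
  simp only [πLow, comp_eq_form]

theorem π_opC_opC_symEnd (he : H.IsAdapted e) (S : H.symTensors) (u v x y : W) :
    H.π (H.opC e S (H.opC e S (H.symEnd u v)) x) y = 2 * H.quadContr e S x y u v := by
  have hB : ∀ z, H.opC e S (H.symEnd u v) z =
      ∑ τ, (2 * H.form S z (H.j (e τ)) u v) • e τ := by
    intro z
    conv_lhs => rw [← he.sum_π_j_smul (H.opC e S (H.symEnd u v) z)]
    simp only [he.π_opC_symEnd]
  have hs : ∀ τ, ∑ σ, H.form S (e σ) (e τ) x y * H.form S (H.j (e σ)) (H.j (e τ)) u v =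
      -∑ σ, H.form S (H.j (e σ)) (e τ) x y * H.form S (e σ) (H.j (e τ)) u v := by
    intro τ
    have h := he.sum_j_swap (((H.form S x y).flip (e τ)).smulRight
      ((H.form S u v).flip (H.j (e τ))))
    simp only [LinearMap.smulRight_apply, LinearMap.smul_apply, LinearMap.flip_apply, smul_eq_mul,
      form_pair_swap S x y, form_pair_swap S u v] at h
    exact h
  rw [he.π_opC, quadContr, Finset.sum_comm]
  simp only [hs, hB, map_sum, map_smul, LinearMap.sum_apply, LinearMap.smul_apply, smul_eq_mul]
  rw [Finset.sum_comm, Finset.sum_neg_distrib, mul_neg, Finset.mul_sum]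
  simp only [Finset.mul_sum]
  congr 1
  refine Finset.sum_congr rfl fun τ _ => Finset.sum_congr rfl fun σ _ => ?_
  ring

theorem condI_iff_𝒯 (he : H.IsAdapted e) [FiniteDimensional ℂ W] (S : H.symTensors) :
    H.CondI e S ↔ ∀ A : H.sp, H.𝒯 (H.𝒦 S) (H.𝒯 (H.𝒦 S) A) =
      (2 : ℝ) • H.𝒯 (H.𝒦 S) A + (21 / 4 : ℝ) • A := by
  let φ : Module.End ℂ W →ₗ[ℂ] Module.End ℂ W :=
    H.opC e S ∘ₗ H.opC e S - (2 : ℂ) • H.opC e S - (21 / 4 : ℂ) • LinearMap.id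
  have hφ : ∀ B, φ B = H.opC e S (H.opC e S B) - (2 : ℂ) • H.opC e S B - (21 / 4 : ℂ) • B :=
    fun _ => rfl
  have r : ∀ (c : ℝ) (x : W), (c : ℂ) • x = c • x := fun c x => algebraMap_smul ℂ c x
  have r2 : ∀ x : W, (2 : ℂ) • x = (2 : ℝ) • x := fun x => by rw [← r]; norm_num
  have r3 : ∀ x : W, (21 / 4 : ℂ) • x = (21 / 4 : ℝ) • x := fun x => by rw [← r]; norm_num
  have h1 : (∀ A : H.sp, H.𝒯 (H.𝒦 S) (H.𝒯 (H.𝒦 S) A) =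
      (2 : ℝ) • H.𝒯 (H.𝒦 S) A + (21 / 4 : ℝ) • A) ↔ ∀ A : H.sp, φ (H.cEnd A) = 0 := by
    refine forall_congr' fun A => ?_
    rw [hφ, ← he.cEnd_𝒯, ← he.cEnd_𝒯, sub_sub, sub_eq_zero, Subtype.ext_iff, LinearMap.ext_iff,
      LinearMap.ext_iff]
    refine forall_congr' fun x => ?_
    simp only [LinearMap.add_apply, LinearMap.smul_apply, r2, r3]
    rfl
  rw [h1]
  have h2 : (∀ A : H.sp, φ (H.cEnd A) = 0) ↔ ∀ γ δ, φ (H.symEnd (e γ) (e δ)) = 0 :=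
    ⟨fun h γ δ => H.map_symEnd_eq_zero φ h _ _, fun h A =>
      H.map_cEnd_eq_zero he φ (H.map_symEnd_eq_zero_of_basis e φ h) A⟩
  rw [h2, he.condI_iff_quadContr]
  have h3 : ∀ α β γ δ, H.π (φ (H.symEnd (e γ) (e δ)) (e α)) (e β) =
      2 * (H.quadContr e S (e α) (e β) (e γ) (e δ) - (2 * H.form S (e α) (e β) (e γ) (e δ) +
        21 / 8 * (H.π (e α) (e γ) * H.π (e β) (e δ) + H.π (e α) (e δ) * H.π (e β) (e γ)))) := by
    intro α β γ δ
    rw [hφ]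
    simp only [LinearMap.sub_apply, LinearMap.smul_apply, map_sub, map_smul, he.π_opC_opC_symEnd,
      he.π_opC_symEnd, π_symEnd, smul_eq_mul]
    rw [H.π_swap (e α) (e γ), H.π_swap (e α) (e δ), H.π_swap (e β) (e γ), H.π_swap (e β) (e δ)]
    ring
  constructor
  · intro h γ δ
    refine e.ext fun α => ?_
    have : H.π (φ (H.symEnd (e γ) (e δ)) (e α)) = 0 :=
      e.ext fun β => by rw [h3, h, sub_self, mul_zero, LinearMap.zero_apply]
    exact H.π_ext fun z => by rw [this, LinearMap.zero_apply, LinearMap.zero_apply, map_zero,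
      LinearMap.zero_apply]
  · intro h α β γ δ
    have := h3 α β γ δ
    rw [h, LinearMap.zero_apply, map_zero, LinearMap.zero_apply, eq_comm, mul_eq_zero] at this
    exact sub_eq_zero.mp (this.resolve_left two_ne_zero)

theorem condI_iff (he : H.IsAdapted e) [FiniteDimensional ℂ W] (S : H.symTensors) :
    H.CondI e S ↔ H.P (H.𝒦 S) ∘ₗ H.P (H.𝒦 S) = H.P (H.𝒦 S) := by
  rw [he.condI_iff_𝒯, LinearMap.ext_iff]
  refine forall_congr' fun A => ?_
  have h : (H.P (H.𝒦 S) ∘ₗ H.P (H.𝒦 S)) A - H.P (H.𝒦 S) A = (1 / 25 : ℝ) •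
      (H.𝒯 (H.𝒦 S) (H.𝒯 (H.𝒦 S) A) - ((2 : ℝ) • H.𝒯 (H.𝒦 S) A + (21 / 4 : ℝ) • A)) := by
    simp only [P, LinearMap.comp_apply, LinearMap.add_apply, LinearMap.smul_apply,
      LinearMap.id_apply, map_add, map_smul]
    module
  rw [← sub_eq_zero, ← sub_eq_zero (b := H.P (H.𝒦 S) A), h,
    smul_eq_zero_iff_right (by norm_num : (1 / 25 : ℝ) ≠ 0)]

end IsAdapted

namespace IsAdapted

/-! ### The second condition -/

theorem condII_iff_form (he : H.IsAdapted e) (S : H.symTensors) :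
    H.CondII e S ↔ ∀ (μ ν : Fin 4) (x : W),
      (∑ σ, H.form S (e σ) x x x * H.form S (H.j (e σ)) x (e μ) (e ν)) +
        3 / 4 * H.form S x x x (e μ) * H.π (e ν) x +
        3 / 4 * H.form S x x x (e ν) * H.π (e μ) x = 0 := by
  have key : ∀ (μ ν : Fin 4) (x : Fin 4 → ℂ), ∑ α, ∑ β, ∑ γ, ∑ δ,
      ((∑ σ, ∑ τ, H.πUp e σ τ * H.comp e S σ α β γ * H.comp e S τ δ μ ν) +
        3 / 4 * H.comp e S α β γ μ * H.πLow e ν δ +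
        3 / 4 * H.comp e S α β γ ν * H.πLow e μ δ) * x α * x β * x γ * x δ =
      (∑ σ, H.form S (e σ) (∑ α, x α • e α) (∑ α, x α • e α) (∑ α, x α • e α) *
          H.form S (H.j (e σ)) (∑ α, x α • e α) (e μ) (e ν)) +
        3 / 4 * H.form S (∑ α, x α • e α) (∑ α, x α • e α) (∑ α, x α • e α) (e μ) *
          H.π (e ν) (∑ α, x α • e α) +
        3 / 4 * H.form S (∑ α, x α • e α) (∑ α, x α • e α) (∑ α, x α • e α) (e ν) *
          H.π (e μ) (∑ α, x α • e α) := by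
    intro μ ν x
    have hc : ∀ α β γ δ, ∑ σ, ∑ τ, H.πUp e σ τ * H.comp e S σ α β γ * H.comp e S τ δ μ ν =
        ∑ σ, H.form S (e σ) (e α) (e β) (e γ) * H.form S (H.j (e σ)) (e δ) (e μ) (e ν) := by
      intro α β γ δ
      have h := he.sum_πUp_mul (((H.form S (e α) (e β)).flip (e γ)))
        ((H.form S (e μ) (e ν)).flip (e δ))
      have h1 : ∀ u, H.form S (e α) (e β) u (e γ) = H.form S u (e α) (e β) (e γ) := by
        intro u
        rw [H.form_swap12, H.form_swap01]
      simp only [LinearMap.flip_apply, h1, form_pair_swap S (e μ) (e ν)] at h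
      simp only [comp_eq_form, mul_assoc, h]
    simp only [hc]
    simp only [comp_eq_form, πLow]
    refine sum_components e (fun x y z w => (∑ σ, H.form S (e σ) x y z *
        H.form S (H.j (e σ)) w (e μ) (e ν)) + 3 / 4 * H.form S x y z (e μ) * H.π (e ν) w +
        3 / 4 * H.form S x y z (e ν) * H.π (e μ) w) ?_ ?_ ?_ ?_ x
    all_goals
      intro a b c
      constructor
      · intro u v
        simp only [map_add, LinearMap.add_apply, add_mul, mul_add, Finset.sum_add_distrib]
        ring
      · intro c u
        simp only [map_smul, LinearMap.smul_apply, smul_eq_mul, mul_add, Finset.mul_sum]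
        refine congrArg₂ _ (congrArg₂ _ (Finset.sum_congr rfl fun σ _ => ?_) ?_) ?_ <;> ring
  simp only [CondII, key]
  refine forall₂_congr fun μ ν => ⟨fun h x => ?_, fun h x => h _⟩
  have := h (e.repr x)
  rwa [e.sum_repr] at this

theorem π_lie_𝒯 (he : H.IsAdapted e) (S : H.symTensors) (D : H.sp) (u v x y : W) :
    H.π ((H.cEnd D * H.opC e S (H.symEnd u v) - H.opC e S (H.symEnd u v) * H.cEnd D -
        H.opC e S (H.cEnd D * H.symEnd u v - H.symEnd u v * H.cEnd D)) x) y =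
      -2 * derivForm S D x y u v := by
  rw [commutator_symEnd, map_add]
  simp only [LinearMap.sub_apply, LinearMap.add_apply, Module.End.mul_apply, map_sub, map_add,
    cEnd_apply, π_sp, he.π_opC_symEnd, derivForm]
  ring

/-- An element `D` of `sp(2)` satisfies `[D, 𝒯 B] = 𝒯 [D, B]` for all `B` if and only if it
annihilates the quartic form of `S`: both say that the derivation `D` annihilates `S`. -/
theorem lie_𝒯_iff (he : H.IsAdapted e) [FiniteDimensional ℂ W] (S : H.symTensors) (D : H.sp) :
    (∀ B : H.sp, ⁅D, H.𝒯 (H.𝒦 S) B⁆ = H.𝒯 (H.𝒦 S) ⁅D, B⁆) ↔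
      ∀ x, H.form S (D.1 x) x x x = 0 := by
  let φ : Module.End ℂ W →ₗ[ℂ] Module.End ℂ W :=
    LinearMap.mulLeft ℂ (H.cEnd D) ∘ₗ H.opC e S - LinearMap.mulRight ℂ (H.cEnd D) ∘ₗ H.opC e S -
      H.opC e S ∘ₗ (LinearMap.mulLeft ℂ (H.cEnd D) - LinearMap.mulRight ℂ (H.cEnd D))
  have hφ : ∀ B, φ B = H.cEnd D * H.opC e S B - H.opC e S B * H.cEnd D -
      H.opC e S (H.cEnd D * B - B * H.cEnd D) := fun _ => rfl
  have hlie : ∀ A B : H.sp, H.cEnd ⁅A, B⁆ = H.cEnd A * H.cEnd B - H.cEnd B * H.cEnd A :=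
    fun _ _ => rfl
  have h1 : (∀ B : H.sp, ⁅D, H.𝒯 (H.𝒦 S) B⁆ = H.𝒯 (H.𝒦 S) ⁅D, B⁆) ↔
      ∀ B : H.sp, φ (H.cEnd B) = 0 := by
    refine forall_congr' fun B => ?_
    rw [hφ, ← hlie, ← he.cEnd_𝒯, ← he.cEnd_𝒯, ← hlie, sub_eq_zero, Subtype.ext_iff,
      LinearMap.ext_iff, LinearMap.ext_iff]
    rfl
  rw [h1]
  constructor
  · intro h x
    have h2 := he.π_lie_𝒯 S D x x x x
    rw [← hφ, H.map_symEnd_eq_zero φ h, LinearMap.zero_apply, map_zero, LinearMap.zero_apply,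
      derivForm, H.form_swap23 S x x x (D.1 x), H.form_swap12 S x x (D.1 x) x,
      H.form_swap01 S x (D.1 x) x x] at h2
    linear_combination h2 / 8
  · intro h B
    refine H.map_cEnd_eq_zero he φ (fun u v => ?_) B
    ext x
    refine H.π_ext fun y => ?_
    rw [hφ, he.π_lie_𝒯, derivForm_eq_zero S D h, mul_zero, LinearMap.zero_apply, map_zero,
      LinearMap.zero_apply]

theorem condII_iff_P (he : H.IsAdapted e) [FiniteDimensional ℂ W] (S : H.symTensors) :
    H.CondII e S ↔ ∀ (A : H.sp) (x : W), H.form S ((H.P (H.𝒦 S) A).1 x) x x x = 0 := by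
  let ψ : W → Module.End ℂ W →ₗ[ℂ] ℂ := fun x =>
    (((H.form S).flip x).flip x).flip x ∘ₗ
      (LinearMap.applyₗ x : Module.End ℂ W →ₗ[ℂ] W) ∘ₗ (H.opC e S + (3 / 2 : ℂ) • LinearMap.id)
  have hψ : ∀ x B, ψ x B = H.form S (H.opC e S B x + (3 / 2 : ℂ) • B x) x x x := fun _ _ => rfl
  have h1 : ∀ (A : H.sp) (x : W), (H.P (H.𝒦 S) A).1 x =
      (1 / 5 : ℂ) • (H.opC e S (H.cEnd A) x + (3 / 2 : ℂ) • H.cEnd A x) := by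
    intro A x
    have r : ∀ (c : ℝ) (x : W), c • x = (c : ℂ) • x := fun c x => (algebraMap_smul ℂ c x).symm
    have : (H.P (H.𝒦 S) A).1 x =
        (1 / 5 : ℝ) • (H.𝒯 (H.𝒦 S) A).1 x + (3 / 10 : ℝ) • A.1 x := rfl
    rw [this, ← he.cEnd_𝒯, cEnd_apply, cEnd_apply, r, r]
    push_cast
    module
  have h2 : (∀ (A : H.sp) (x : W), H.form S ((H.P (H.𝒦 S) A).1 x) x x x = 0) ↔
      ∀ (x : W) (A : H.sp), ψ x (H.cEnd A) = 0 := by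
    rw [forall_comm]
    refine forall₂_congr fun x A => ?_
    rw [h1, hψ]
    simp only [map_smul, LinearMap.smul_apply]
    rw [smul_eq_zero_iff_right (by norm_num)]
  have h3 : ∀ x, (∀ A : H.sp, ψ x (H.cEnd A) = 0) ↔
      ∀ μ ν, ψ x (H.symEnd (e μ) (e ν)) = 0 := fun x =>
    ⟨fun h μ ν => H.map_symEnd_eq_zero _ h _ _, fun h A =>
      H.map_cEnd_eq_zero he _ (H.map_symEnd_eq_zero_of_basis e _ h) A⟩
  have h4 : ∀ x μ ν, ψ x (H.symEnd (e μ) (e ν)) = 2 *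
      ((∑ σ, H.form S (e σ) x x x * H.form S (H.j (e σ)) x (e μ) (e ν)) +
        3 / 4 * H.form S x x x (e μ) * H.π (e ν) x +
        3 / 4 * H.form S x x x (e ν) * H.π (e μ) x) := by
    intro x μ ν
    have hr : ∀ u, H.form S x x x u = H.form S u x x x := by
      intro u
      rw [H.form_swap23, H.form_swap12, H.form_swap01]
    have hx : ∀ σ, H.form S (H.j (e σ)) x (e μ) (e ν) = H.form S x (H.j (e σ)) (e μ) (e ν) :=
      fun σ => H.form_swap01 S _ _ _ _
    rw [hψ, ← he.sum_π_j_smul (H.opC e S (H.symEnd (e μ) (e ν)) x)]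
    simp only [he.π_opC_symEnd, symEnd_apply, map_add, map_sum, map_smul, LinearMap.add_apply,
      LinearMap.sum_apply, LinearMap.smul_apply, smul_eq_mul, hr, hx]
    rw [add_assoc, mul_add (2 : ℂ), Finset.mul_sum]
    refine congrArg₂ _ (Finset.sum_congr rfl fun σ _ => ?_) ?_ <;> ring
  rw [h2, he.condII_iff_form]
  simp only [h3, h4, mul_eq_zero, two_ne_zero, false_or]
  exact ⟨fun h x μ ν => h μ ν x, fun h μ ν x => h x μ ν⟩

theorem condII_iff (he : H.IsAdapted e) [FiniteDimensional ℂ W] (S : H.symTensors) :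
    H.CondII e S ↔ ∀ A B : H.sp,
      ⁅H.P (H.𝒦 S) A, H.P (H.𝒦 S) B⁆ = H.P (H.𝒦 S) ⁅H.P (H.𝒦 S) A, B⁆ := by
  rw [he.condII_iff_P]
  refine forall_congr' fun A => ?_
  rw [← he.lie_𝒯_iff]
  refine forall_congr' fun B => ?_
  set D := H.P (H.𝒦 S) A
  have h : ⁅D, H.P (H.𝒦 S) B⁆ - H.P (H.𝒦 S) ⁅D, B⁆ =
      (1 / 5 : ℝ) • (⁅D, H.𝒯 (H.𝒦 S) B⁆ - H.𝒯 (H.𝒦 S) ⁅D, B⁆) := by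
    have e1 : H.P (H.𝒦 S) B = (1 / 5 : ℝ) • H.𝒯 (H.𝒦 S) B + (3 / 10 : ℝ) • B := rfl
    have e2 : H.P (H.𝒦 S) ⁅D, B⁆ = (1 / 5 : ℝ) • H.𝒯 (H.𝒦 S) ⁅D, B⁆ + (3 / 10 : ℝ) • ⁅D, B⁆ := rfl
    rw [e1, e2, lie_add, lie_smul, lie_smul]
    module
  rw [← sub_eq_zero, ← sub_eq_zero (b := H.P (H.𝒦 S) ⁅D, B⁆), h,
    smul_eq_zero_iff_right (by norm_num : (1 / 5 : ℝ) ≠ 0)]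

end IsAdapted

/-! ### The discriminant satisfies both conditions -/

/-- The polarization of `disc`. -/
def discPolar (x y z w : Fin 4 → ℂ) : ℂ :=
  -(3 / 4) * (
    x 0 * y 1 * z 2 * w 3 + x 0 * y 1 * z 3 * w 2 + x 0 * y 2 * z 1 * w 3 +
      x 0 * y 2 * z 3 * w 1 + x 0 * y 3 * z 1 * w 2 + x 0 * y 3 * z 2 * w 1 +
      x 1 * y 0 * z 2 * w 3 + x 1 * y 0 * z 3 * w 2 + x 1 * y 2 * z 0 * w 3 +
      x 1 * y 2 * z 3 * w 0 + x 1 * y 3 * z 0 * w 2 + x 1 * y 3 * z 2 * w 0 +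
      x 2 * y 0 * z 1 * w 3 + x 2 * y 0 * z 3 * w 1 + x 2 * y 1 * z 0 * w 3 +
      x 2 * y 1 * z 3 * w 0 + x 2 * y 3 * z 0 * w 1 + x 2 * y 3 * z 1 * w 0 +
      x 3 * y 0 * z 1 * w 2 + x 3 * y 0 * z 2 * w 1 + x 3 * y 1 * z 0 * w 2 +
      x 3 * y 1 * z 2 * w 0 + x 3 * y 2 * z 0 * w 1 + x 3 * y 2 * z 1 * w 0) +
  (√3 : ℝ) * (
    x 0 * y 3 * z 3 * w 3 + x 3 * y 0 * z 3 * w 3 + x 3 * y 3 * z 0 * w 3 + x 3 * y 3 * z 3 * w 0) +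
  -(√3 : ℝ) * (
    x 1 * y 1 * z 1 * w 2 + x 1 * y 1 * z 2 * w 1 + x 1 * y 2 * z 1 * w 1 + x 2 * y 1 * z 1 * w 1) +
  1 / 2 * (
    x 1 * y 1 * z 3 * w 3 + x 1 * y 3 * z 1 * w 3 + x 1 * y 3 * z 3 * w 1 +
      x 3 * y 1 * z 1 * w 3 + x 3 * y 1 * z 3 * w 1 + x 3 * y 3 * z 1 * w 1) +
  -(3 / 2) * (
    x 0 * y 0 * z 2 * w 2 + x 0 * y 2 * z 0 * w 2 + x 0 * y 2 * z 2 * w 0 +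
      x 2 * y 0 * z 0 * w 2 + x 2 * y 0 * z 2 * w 0 + x 2 * y 2 * z 0 * w 0)

theorem discPolar_diag (x : Fin 4 → ℂ) : discPolar x x x x = disc x := by
  simp only [discPolar, disc]
  ring

theorem discPolar_swap01 (x y z w : Fin 4 → ℂ) : discPolar x y z w = discPolar y x z w := by
  simp only [discPolar]
  ring

theorem discPolar_swap12 (x y z w : Fin 4 → ℂ) : discPolar x y z w = discPolar x z y w := by
  simp only [discPolar]
  ring

theorem discPolar_swap23 (x y z w : Fin 4 → ℂ) : discPolar x y z w = discPolar x y w z := by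
  simp only [discPolar]
  ring

theorem discPolar_add (x x' y z w : Fin 4 → ℂ) :
    discPolar (x + x') y z w = discPolar x y z w + discPolar x' y z w := by
  simp only [discPolar, Pi.add_apply]
  ring

theorem form_eq_discPolar (S : H.symTensors)
    (h : ∀ x : W, S.1 ![H.ι x, H.ι x, H.ι x, H.ι x] = disc (e.repr x)) (x y z w : W) :
    H.form S x y z w = discPolar (e.repr x) (e.repr y) (e.repr z) (e.repr w) := by
  rw [← sub_eq_zero]
  refine eq_zero_of_diagonal (fun x y z w => H.form S x y z w -
    discPolar (e.repr x) (e.repr y) (e.repr z) (e.repr w)) ?_ ?_ ?_ ?_ ?_ x y z w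
  · intro x x' y z w
    simp only [map_add, LinearMap.add_apply, Finsupp.coe_add, discPolar_add]
    ring
  · intro x y z w
    rw [H.form_swap01, discPolar_swap01]
  · intro x y z w
    rw [H.form_swap12, discPolar_swap12]
  · intro x y z w
    rw [H.form_swap23, discPolar_swap23]
  · intro x
    simp only [discPolar_diag, ← h, form_apply, sub_self]

namespace IsAdapted

theorem condI_of_disc (he : H.IsAdapted e) (S : H.symTensors)
    (h : ∀ x : W, S.1 ![H.ι x, H.ι x, H.ι x, H.ι x] = disc (e.repr x)) : H.CondI e S := by
  have h3 : ((√3 : ℝ) : ℂ) * ((√3 : ℝ) : ℂ) = 3 := by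
    rw [← Complex.ofReal_mul, Real.mul_self_sqrt (by norm_num)]
    norm_num
  rw [he.condI_iff_quadContr]
  let F : W → W → W → W → ℂ := fun x y z w => H.quadContr e S x y z w - (2 * H.form S x y z w +
    21 / 8 * (H.π x z * H.π y w + H.π x w * H.π y z))
  -- both sides are symmetric in the first two and in the last two arguments
  have hF : ∀ x y z w, F x y z w = 0 := by
    have diag : ∀ x z, F x x z z = 0 := by
      intro x z
      simp only [F, quadContr, Fin.sum_univ_four, form_eq_discPolar S h, he.π_eq, he.j0, he.j1,
        he.j2, he.j3]
      simp only [map_neg, Finsupp.coe_neg, Pi.neg_apply, e.repr_self, discPolar,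
        Finsupp.single_apply]
      simp
      linear_combination (2 * e.repr x 3 ^ 2 * e.repr z 1 ^ 2 -
        4 * e.repr x 0 * e.repr x 3 * e.repr z 1 * e.repr z 2 -
        4 * e.repr x 1 * e.repr x 2 * e.repr z 0 * e.repr z 3 +
        2 * e.repr x 1 ^ 2 * e.repr z 3 ^ 2) * h3
    have hxx : ∀ x z w, F x x z w = 0 := by
      intro x z w
      refine eq_zero_of_diagonal₂ (F x x) ?_ ?_ (diag x) z w
      · intro z z' w
        simp only [F, quadContr, map_add, LinearMap.add_apply, mul_add, add_mul,
          Finset.sum_add_distrib]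
        ring
      · intro z w
        simp only [F, quadContr, H.form_swap23 S _ _ z w]
        ring
    intro x y z w
    refine eq_zero_of_diagonal₂ (fun x y => F x y z w) ?_ ?_ (fun x => hxx x z w) x y
    · intro x x' y
      simp only [F, quadContr, map_add, LinearMap.add_apply, mul_add, add_mul,
        Finset.sum_add_distrib]
      ring
    · intro x y
      simp only [F, quadContr, H.form_swap23 S _ _ x y, H.form_swap01 S x y]
      ring
  exact fun α β γ δ => sub_eq_zero.mp (hF _ _ _ _)

set_option maxHeartbeats 1000000 in
/-- For each pair `μ, ν` this is a polynomial identity in `x`, which holds modulo `√3² = 3`. -/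
theorem condII_of_disc (he : H.IsAdapted e) (S : H.symTensors)
    (h : ∀ x : W, S.1 ![H.ι x, H.ι x, H.ι x, H.ι x] = disc (e.repr x)) : H.CondII e S := by
  have h3 : ((√3 : ℝ) : ℂ) * ((√3 : ℝ) : ℂ) = 3 := by
    rw [← Complex.ofReal_mul, Real.mul_self_sqrt (by norm_num)]
    norm_num
  rw [he.condII_iff_form]
  intro μ ν x
  simp only [Fin.sum_univ_four, form_eq_discPolar S h, he.π_eq, he.j0, he.j1,
        he.j2, he.j3]
  fin_cases μ <;> fin_cases ν <;> simp [discPolar]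
  all_goals first
    | ring1
    | linear_combination (-e.repr x 3 ^ 3 * e.repr x 1 +
        3 * e.repr x 0 * e.repr x 3 ^ 2 * e.repr x 2) * h3
    | linear_combination (-3 * e.repr x 1 ^ 2 * e.repr x 2 * e.repr x 3) * h3
    | linear_combination (-3 * e.repr x 1 ^ 2 * e.repr x 2 * e.repr x 0 +
        e.repr x 1 ^ 3 * e.repr x 3) * h3
    | linear_combination (3 * e.repr x 0 * e.repr x 3 ^ 2 * e.repr x 1) * h3

end IsAdapted

/-! ### Adapted eigenbases -/

/-- Two unit vectors `v₀, v₁` with `v₁` orthogonal to `v₀` and `j v₀` are the first half of an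
adapted basis. -/
theorem exists_isAdapted (hd : Module.finrank ℂ W = 4) {v₀ v₁ : W}
    (h00 : H.π v₀ (H.j v₀) = 1) (h11 : H.π v₁ (H.j v₁) = 1) (h01 : H.π v₀ v₁ = 0)
    (h01' : H.π v₀ (H.j v₁) = 0) :
    ∃ e : Module.Basis (Fin 4) ℂ W, H.IsAdapted e ∧ e 0 = v₀ ∧ e 1 = v₁ := by
  have h10 : H.π v₁ v₀ = 0 := by rw [H.π_swap, h01, neg_zero]
  have h10' : H.π v₁ (H.j v₀) = 0 := by
    rw [H.π_swap, H.π_j_left, h01', map_zero, neg_zero, neg_zero]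
  have k00 : H.π (H.j v₀) v₀ = -1 := by rw [H.π_swap, h00]
  have k11 : H.π (H.j v₁) v₁ = -1 := by rw [H.π_swap, h11]
  have k01 : H.π (H.j v₀) v₁ = 0 := by rw [H.π_swap, h10', neg_zero]
  have k10 : H.π (H.j v₁) v₀ = 0 := by rw [H.π_swap, h01', neg_zero]
  have gram : ∀ a b, H.π (![v₀, v₁, H.j v₀, H.j v₁] a) (H.j (![v₀, v₁, H.j v₀, H.j v₁] b)) =
      if a = b then 1 else 0 := by
    intro a b
    fin_cases a <;> fin_cases b <;>
      simp [h00, h11, h01, h01', h10, h10', k00, k11, k01, k10, H.j_j, H.π_j_j, H.π_self]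
  have li : LinearIndependent ℂ ![v₀, v₁, H.j v₀, H.j v₁] := by
    rw [Fintype.linearIndependent_iff]
    intro c hc b
    have := congrArg (fun t => H.π t (H.j (![v₀, v₁, H.j v₀, H.j v₁] b))) hc
    simp only [map_sum, map_smul, LinearMap.sum_apply, LinearMap.smul_apply, gram] at this
    simpa using this
  let e := basisOfLinearIndependentOfCardEqFinrank li (by rw [hd, Fintype.card_fin])
  have he : ⇑e = ![v₀, v₁, H.j v₀, H.j v₁] := coe_basisOfLinearIndependentOfCardEqFinrank li _
  refine ⟨e, ⟨?_, ?_, fun x y => ?_⟩, ?_, ?_⟩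
  · rw [he]; rfl
  · rw [he]; rfl
  · simp only [Module.Basis.coord_apply]
    conv_lhs => rw [← e.sum_repr x, ← e.sum_repr y]
    simp only [Fin.sum_univ_four, he, map_add, map_smul, LinearMap.add_apply, LinearMap.smul_apply,
      Matrix.cons_val, smul_eq_mul, h00, h11, h01, h01', h10, h10', k00, k11, k01, k10, H.π_j_j,
      H.π_self, map_zero]
    ring
  · rw [he]; rfl
  · rw [he]; rfl

/-- In an invariant quaternionic subspace, `D ∈ sp(n)` has a unit eigenvector with eigenvalue in
`i ℝ_{≥ 0}`. -/
theorem exists_unit_eigenvector [FiniteDimensional ℂ W] (D : H.sp) (U : Submodule ℂ W)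
    (hU : U ≠ ⊥) (hD : ∀ x ∈ U, D.1 x ∈ U) (hj : ∀ x ∈ U, H.j x ∈ U) :
    ∃ v ∈ U, H.π v (H.j v) = 1 ∧ ∃ t : ℝ, 0 ≤ t ∧ D.1 v = (t * Complex.I) • v := by
  have : Nontrivial U := Submodule.nontrivial_iff_ne_bot.mpr hU
  obtain ⟨c, hc⟩ := Module.End.exists_eigenvalue ((H.cEnd D).restrict (p := U) (q := U) hD)
  obtain ⟨u, hu⟩ := hc.exists_hasEigenvector
  have hu0 : (u : W) ≠ 0 := fun h => hu.2 (Subtype.ext h)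
  have hDu : D.1 u = c • (u : W) := congrArg Subtype.val hu.apply_eq_smul
  have hpos := H.π_pos u hu0
  have hcc : c = -starRingEnd ℂ c := by
    have h := H.π_sp D u (H.j u)
    rw [H.sp_j, hDu, H.j.map_smulₛₗ, map_smul, map_smul, LinearMap.smul_apply, smul_eq_mul,
      smul_eq_mul, ← neg_mul] at h
    exact mul_right_cancel₀ hpos.ne' h
  have hre : c.re = 0 := by
    have := congrArg Complex.re hcc
    rw [Complex.neg_re, Complex.conj_re] at this
    linarith
  have hcI : c = c.im * Complex.I := by
    nth_rewrite 1 [← Complex.re_add_im c]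
    rw [hre, Complex.ofReal_zero, zero_add]
  -- replacing `u` by `j u` changes the sign of the eigenvalue
  obtain ⟨v, hv, hv0, t, ht, hDv⟩ : ∃ v ∈ U, v ≠ 0 ∧ ∃ t : ℝ, 0 ≤ t ∧
      D.1 v = (t * Complex.I) • v := by
    rcases le_total 0 c.im with h | h
    · exact ⟨u, u.2, hu0, c.im, h, by rw [hDu]; exact congrArg (· • (u : W)) hcI⟩
    · refine ⟨H.j u, hj _ u.2, fun h0 => hu0 ?_, -c.im, by linarith, ?_⟩
      · rw [← neg_eq_zero, ← H.j_j, h0, map_zero]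
      · rw [H.sp_j, hDu, H.j.map_smulₛₗ]
        congr 1
        nth_rewrite 1 [hcI]
        simp
  have hpos := H.π_pos v hv0
  obtain ⟨r, hr, hrv⟩ : ∃ r : ℝ, 0 < r ∧ H.π v (H.j v) = r :=
    ⟨(H.π v (H.j v)).re, (Complex.lt_def.mp hpos).1, (Complex.ext rfl
      (by rw [Complex.ofReal_im]; exact (Complex.lt_def.mp hpos).2.symm))⟩
  refine ⟨(((√r)⁻¹ : ℝ) : ℂ) • v, U.smul_mem _ hv, ?_, t, ht, ?_⟩
  · rw [H.j.map_smulₛₗ, map_smul, map_smul, LinearMap.smul_apply, Complex.conj_ofReal, hrv,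
      smul_eq_mul, smul_eq_mul, ← mul_assoc]
    have h : (√r)⁻¹ * (√r)⁻¹ * r = 1 := by
      rw [← mul_inv, Real.mul_self_sqrt hr.le, inv_mul_cancel₀ hr.ne']
    exact_mod_cast h
  · rw [← cEnd_apply, map_smul, cEnd_apply, hDv, smul_comm]

theorem exists_adapted_eigenbasis [FiniteDimensional ℂ W] (hd : Module.finrank ℂ W = 4)
    (D : H.sp) :
    ∃ e : Module.Basis (Fin 4) ℂ W, H.IsAdapted e ∧ ∃ l m : ℝ, 0 ≤ m ∧ m ≤ l ∧
      D.1 (e 0) = (l * Complex.I) • e 0 ∧ D.1 (e 1) = (m * Complex.I) • e 1 := by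
  have : Nontrivial W := Module.nontrivial_of_finrank_pos (R := ℂ) (by omega)
  obtain ⟨v, -, hv, s, hs, hDv⟩ := exists_unit_eigenvector D ⊤ top_ne_bot
    (fun _ _ => trivial) (fun _ _ => trivial)
  let f : W →ₗ[ℂ] ℂ × ℂ := (H.π v).prod (H.π (H.j v))
  have hf : LinearMap.ker f ≠ ⊥ :=
    LinearMap.ker_ne_bot_of_finrank_lt (by
      rw [hd, Module.finrank_prod, Module.finrank_self]
      norm_num)
  have mem : ∀ x, x ∈ LinearMap.ker f ↔ H.π v x = 0 ∧ H.π (H.j v) x = 0 := by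
    intro x
    rw [LinearMap.mem_ker]
    exact Prod.ext_iff
  obtain ⟨u, hu, huu, t, ht, hDu⟩ := exists_unit_eigenvector D (LinearMap.ker f) hf
    (by
      intro x hx
      rw [mem] at hx ⊢
      have h1 := H.π_sp D v x
      have h2 := H.π_sp D (H.j v) x
      rw [hDv, map_smul, LinearMap.smul_apply, hx.1, smul_zero, eq_comm, neg_eq_zero] at h1
      rw [H.sp_j, hDv, H.j.map_smulₛₗ, map_smul, LinearMap.smul_apply, hx.2, smul_zero, eq_comm,
        neg_eq_zero] at h2
      exact ⟨h1, h2⟩)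
    (by
      intro x hx
      rw [mem] at hx ⊢
      rw [H.π_j_j, hx.1, map_zero]
      have := H.π_j_left v x
      rw [hx.2, eq_comm, neg_eq_zero, map_eq_zero] at this
      exact ⟨this, rfl⟩)
  rw [mem] at hu
  have hju : H.π v (H.j u) = 0 := by
    have := H.π_j_left v u
    rwa [hu.2, eq_comm, neg_eq_zero, map_eq_zero] at this
  rcases le_total t s with h | h
  · obtain ⟨e, he, h0, h1⟩ := exists_isAdapted hd hv huu hu.1 hju
    exact ⟨e, he, s, t, ht, h, by rw [h0, hDv], by rw [h1, hDu]⟩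
  · obtain ⟨e, he, h0, h1⟩ := exists_isAdapted hd huu hv (by rw [H.π_swap, hu.1, neg_zero])
      (by rw [H.π_swap, hu.2, neg_zero])
    exact ⟨e, he, t, s, hs, h, by rw [h0, hDu], by rw [h1, hDv]⟩

/-- Adapted bases may be rotated by a phase in the first quaternionic line. -/
theorem IsAdapted.exists_rotate (he : H.IsAdapted e) {ζ : ℂ} (hζ : ζ * starRingEnd ℂ ζ = 1) :
    ∃ e' : Module.Basis (Fin 4) ℂ W, H.IsAdapted e' ∧ e' 0 = ζ • e 0 ∧ e' 1 = e 1 := by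
  refine exists_isAdapted (by rw [Module.finrank_eq_card_basis e, Fintype.card_fin]) ?_ ?_ ?_ ?_
  · rw [H.j.map_smulₛₗ, map_smul, map_smul, LinearMap.smul_apply, he.π_j_eq_repr, e.repr_self,
      Finsupp.single_eq_same, smul_eq_mul, smul_eq_mul, mul_one, mul_comm, hζ]
  · rw [he.π_j_eq_repr, e.repr_self, Finsupp.single_eq_same]
  · rw [map_smul, LinearMap.smul_apply, he.π_eq]
    simp
  · rw [map_smul, LinearMap.smul_apply, he.π_j_eq_repr, e.repr_self]
    simp

/-! ### Weights of the quartic form -/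

/-- The weights `(l, m, -l, -m)` of the vectors of an adapted eigenbasis. -/
def weight (l m : ℝ) : Fin 4 → ℝ := ![l, m, -l, -m]

/-- The adapted basis `e` diagonalizes `D ∈ sp(2)`, with eigenvalues `i l` on `e 0` and `i m` on
`e 1`; those on `e 2 = j (e 0)` and `e 3 = j (e 1)` are then `-i l` and `-i m`. -/
structure IsEigenbasis (H : HyperHermitian W) (e : Module.Basis (Fin 4) ℂ W) (D : H.sp)
    (l m : ℝ) : Prop where
  adapted : H.IsAdapted e
  eigen_zero : D.1 (e 0) = (l * Complex.I) • e 0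
  eigen_one : D.1 (e 1) = (m * Complex.I) • e 1

namespace IsEigenbasis

variable {D : H.sp} {l m : ℝ}

theorem apply_basis (h : H.IsEigenbasis e D l m) (α : Fin 4) :
    D.1 (e α) = (weight l m α * Complex.I) • e α := by
  have h0 := h.eigen_zero
  have h1 := h.eigen_one
  fin_cases α
  · exact h0
  · exact h1
  · change D.1 (e 2) = (((-l : ℝ) : ℂ) * Complex.I) • e 2
    rw [← h.adapted.j0, H.sp_j, h0, H.j.map_smulₛₗ]
    simp
  · change D.1 (e 3) = (((-m : ℝ) : ℂ) * Complex.I) • e 3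
    rw [← h.adapted.j1, H.sp_j, h1, H.j.map_smulₛₗ]
    simp

/-- If `D` annihilates the quartic form, only the components of weight zero survive. -/
theorem form_eq_zero (h : H.IsEigenbasis e D l m) {S : H.symTensors}
    (hS : ∀ x, H.form S (D.1 x) x x x = 0) {α β γ δ : Fin 4}
    (hw : weight l m α + weight l m β + weight l m γ + weight l m δ ≠ 0) :
    H.form S (e α) (e β) (e γ) (e δ) = 0 := by
  have h1 := derivForm_eq_zero S D hS (e α) (e β) (e γ) (e δ)
  simp only [derivForm, h.apply_basis, map_smul, LinearMap.smul_apply, smul_eq_mul] at h1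
  have h2 : (((weight l m α + weight l m β + weight l m γ + weight l m δ : ℝ) : ℂ) * Complex.I) *
      H.form S (e α) (e β) (e γ) (e δ) = 0 := by
    push_cast
    linear_combination h1
  exact (mul_eq_zero.mp h2).resolve_left
    (mul_ne_zero (Complex.ofReal_ne_zero.mpr hw) Complex.I_ne_zero)

/-- The eigenvalue equation `𝒯 D = 7/2 D`, in components. -/
theorem eigenvalue_eq (h : H.IsEigenbasis e D l m) {S : H.symTensors}
    (hT : H.opC e S (H.cEnd D) = (7 / 2 : ℂ) • H.cEnd D) (x y : W) :
    l * H.form S (e 0) (e 2) x y + m * H.form S (e 1) (e 3) x y =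
      (7 / 4 : ℂ) * Complex.I * H.π (D.1 x) y := by
  have h1 := h.adapted.π_opC S (H.cEnd D) x y
  rw [hT] at h1
  simp only [LinearMap.smul_apply, map_smul, smul_eq_mul, cEnd_apply, h.apply_basis,
    Fin.sum_univ_four, h.adapted.j0, h.adapted.j1, h.adapted.j2, h.adapted.j3, map_neg,
    LinearMap.neg_apply, weight, Matrix.cons_val] at h1
  rw [H.form_swap01 S (e 2), H.form_swap01 S (e 3)] at h1
  push_cast at h1
  linear_combination -(Complex.I / 2) * h1 + (l * H.form S (e 0) (e 2) x y +
    m * H.form S (e 1) (e 3) x y) * Complex.I_mul_I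

end IsEigenbasis

/-- The trace of an idempotent matrix is a natural number, its rank. -/
theorem exists_nat_trace_of_idempotent {n : Type*} [Fintype n] [DecidableEq n]
    (Q : Matrix n n ℂ) (hQ : Q * Q = Q) : ∃ k : ℕ, Q.trace = k := by
  have hid : IsIdempotentElem (Matrix.toLin' Q) := by
    rw [IsIdempotentElem, Module.End.mul_eq_comp, ← Matrix.toLin'_mul, hQ]
  have := (LinearMap.IsIdempotentElem.isProj_range _ hid).trace
  rw [Matrix.trace_toLin'_eq] at this
  exact ⟨_, this⟩

namespace IsEigenbasis

variable {D : H.sp} {l m : ℝ}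

/-- Equal weights are impossible: on the span of the `symEnd (e α) (e β)` with `α, β ∈ {0, 1}` the
operator `(𝒯 + 3/2) / 5` would be idempotent of trace `1/5`. -/
theorem ne_of_conditions (h : H.IsEigenbasis e D l m) (hl : 0 < l) {S : H.symTensors}
    (hS : ∀ x, H.form S (D.1 x) x x x = 0)
    (hT : H.opC e S (H.cEnd D) = (7 / 2 : ℂ) • H.cEnd D) (hI : H.CondI e S) : m ≠ l := by
  rintro rfl
  have hl' : (m : ℂ) ≠ 0 := Complex.ofReal_ne_zero.mpr hl.ne'
  have he := h.adapted
  have E0 := h.eigenvalue_eq hT (e 0) (e 2)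
  have E1 := h.eigenvalue_eq hT (e 1) (e 3)
  rw [h.eigen_zero, map_smul, LinearMap.smul_apply, ← he.j0, he.π_j_eq_repr, e.repr_self,
    Finsupp.single_eq_same, smul_eq_mul, he.j0] at E0
  rw [h.eigen_one, map_smul, LinearMap.smul_apply, ← he.j1, he.π_j_eq_repr, e.repr_self,
    Finsupp.single_eq_same, smul_eq_mul, he.j1] at E1
  have tr : H.form S (e 0) (e 2) (e 0) (e 2) + 2 * H.form S (e 0) (e 2) (e 1) (e 3) +
      H.form S (e 1) (e 3) (e 1) (e 3) = -(7 / 2) := by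
    refine mul_left_cancel₀ hl' ?_
    rw [form_pair_swap S (e 1) (e 3) (e 0) (e 2)] at E0
    linear_combination E0 + E1 + (7 / 2 : ℂ) * m * Complex.I_mul_I
  have z : ∀ σ μ α β : Fin 4, (α = 2 ∨ α = 3) → (β = 2 ∨ β = 3) →
      ¬((σ = 0 ∨ σ = 1) ∧ (μ = 0 ∨ μ = 1)) →
      H.form S (e σ) (e μ) (e α) (e β) = 0 := by
    intro σ μ α β hα hβ hn
    refine h.form_eq_zero hS fun hw => hn ?_
    rcases hα with rfl | rfl <;> rcases hβ with rfl | rfl <;> fin_cases σ <;> fin_cases μ <;>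
      first
        | decide
        | (simp only [weight, Fin.zero_eta, Fin.mk_one, Fin.reduceFinMk, Matrix.cons_val] at hw
           linarith)
  have q : ∀ α β γ δ : Fin 4, (α = 2 ∨ α = 3) → (β = 2 ∨ β = 3) →
      H.quadContr e S (e α) (e β) (e γ) (e δ) =
        H.form S (e 0) (e 0) (e α) (e β) * H.form S (e 2) (e 2) (e γ) (e δ) +
        2 * (H.form S (e 0) (e 1) (e α) (e β) * H.form S (e 2) (e 3) (e γ) (e δ)) +
        H.form S (e 1) (e 1) (e α) (e β) * H.form S (e 3) (e 3) (e γ) (e δ) := by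
    intro α β γ δ hα hβ
    have z' := fun σ μ => z σ μ α β hα hβ
    simp only [quadContr, Fin.sum_univ_four, z' 0 2 (by decide), z' 0 3 (by decide),
      z' 1 2 (by decide), z' 1 3 (by decide), z' 2 0 (by decide), z' 2 1 (by decide),
      z' 2 2 (by decide), z' 2 3 (by decide), z' 3 0 (by decide), z' 3 1 (by decide),
      z' 3 2 (by decide), z' 3 3 (by decide), he.j0, he.j1]
    rw [H.form_swap01 S (e 1) (e 0), H.form_swap01 S (e 3) (e 2)]
    ring
  rw [he.condI_iff_quadContr] at hI
  let s : Fin 4 → Fin 4 → Fin 4 → Fin 4 → ℂ := fun α β γ δ => H.form S (e α) (e β) (e γ) (e δ)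
  let p : Fin 4 → Fin 4 → ℂ := fun α β => H.π (e α) (e β)
  have p20 : p 2 0 = -1 := by simp [p, he.π_eq]
  have p21 : p 2 1 = 0 := by simp [p, he.π_eq]
  have p30 : p 3 0 = 0 := by simp [p, he.π_eq]
  have p31 : p 3 1 = -1 := by simp [p, he.π_eq]
  let M : Matrix (Fin 3) (Fin 3) ℂ :=
    !![s 2 2 0 0, s 2 2 0 1, s 2 2 1 1;
       2 * s 2 3 0 0, 2 * s 2 3 0 1, 2 * s 2 3 1 1;
       s 3 3 0 0, s 3 3 0 1, s 3 3 1 1]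
  -- `M` is the matrix of `𝒯` in the basis `symEnd (e 0) (e 0)`, `symEnd (e 0) (e 1)`,
  -- `symEnd (e 1) (e 1)`
  let Q : Matrix (Fin 3) (Fin 3) ℂ := (1 / 5 : ℂ) • (M + (3 / 2 : ℂ) • 1)
  have hQ : Q * Q = Q := by
    have hI' : ∀ α β γ δ : Fin 4, (α = 2 ∨ α = 3) → (β = 2 ∨ β = 3) →
        s α β 0 0 * s 2 2 γ δ + 2 * (s α β 0 1 * s 2 3 γ δ) + s α β 1 1 * s 3 3 γ δ =
        2 * s α β γ δ + 21 / 8 * (p α γ * p β δ + p α δ * p β γ) := by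
      intro α β γ δ hα hβ
      simp only [s, p]
      rw [← hI, q α β γ δ hα hβ, form_pair_swap S (e α) (e β) (e 0) (e 0),
        form_pair_swap S (e α) (e β) (e 0) (e 1), form_pair_swap S (e α) (e β) (e 1) (e 1)]
    have i22 := fun γ δ => hI' 2 2 γ δ (by decide) (by decide)
    have i23 := fun γ δ => hI' 2 3 γ δ (by decide) (by decide)
    have i33 := fun γ δ => hI' 3 3 γ δ (by decide) (by decide)
    have i2200 := i22 0 0
    have i2201 := i22 0 1
    have i2211 := i22 1 1
    have i2300 := i23 0 0
    have i2301 := i23 0 1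
    have i2311 := i23 1 1
    have i3300 := i33 0 0
    have i3301 := i33 0 1
    have i3311 := i33 1 1
    simp only [p20, p21, p30, p31] at i2200 i2201 i2211 i2300 i2301 i2311 i3300 i3301 i3311
    have hM : M * M = (2 : ℂ) • M + (21 / 4 : ℂ) • 1 := by
      ext k n
      fin_cases k <;> fin_cases n <;>
        simp only [M, Matrix.mul_apply, Fin.sum_univ_three, Matrix.of_apply, Matrix.cons_val,
          Matrix.add_apply, Matrix.smul_apply, Matrix.one_apply, smul_eq_mul, Fin.zero_eta,
          Fin.mk_one, Fin.reduceFinMk, Fin.isValue, reduceIte, Fin.reduceEq]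
      · linear_combination i2200
      · linear_combination i2201
      · linear_combination i2211
      · linear_combination 2 * i2300
      · linear_combination 2 * i2301
      · linear_combination 2 * i2311
      · linear_combination i3300
      · linear_combination i3301
      · linear_combination i3311
    simp only [Q, add_mul, mul_add, hM, mul_one, one_mul, smul_mul_assoc,
      mul_smul_comm]
    module
  obtain ⟨k, hk⟩ := exists_nat_trace_of_idempotent Q hQ
  have htr : Q.trace = 1 / 5 := by
    simp only [Q, M, Matrix.trace_smul, Matrix.trace_add, Matrix.trace_one,
      Matrix.trace_fin_three, s, Matrix.of_apply, Matrix.cons_val, smul_eq_mul, Fintype.card_fin]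
    rw [form_pair_swap S (e 2) (e 2), form_pair_swap S (e 2) (e 3), form_pair_swap S (e 3) (e 3),
      H.form_swap12 S (e 0) (e 0), H.form_swap12 S (e 0) (e 1), H.form_swap12 S (e 1) (e 1)]
    push_cast
    linear_combination tr / 5
  have h5 : ((5 * k : ℕ) : ℂ) = ((1 : ℕ) : ℂ) := by
    push_cast
    rw [← hk, htr]
    norm_num
  have := Nat.cast_injective h5
  omega

end IsEigenbasis

namespace IsEigenbasis

variable {D : H.sp} {l m : ℝ}

/-- The weights are in the ratio `3 : 1` of the irreducible four-dimensional representation, and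
the components of weight zero are those of the discriminant, up to a phase. -/
theorem components (h : H.IsEigenbasis e D l m) (hl : 0 < l) (hm : 0 ≤ m) (hml : m ≤ l)
    {S : H.symTensors} (hS : ∀ x, H.form S (D.1 x) x x x = 0)
    (hT : H.opC e S (H.cEnd D) = (7 / 2 : ℂ) • H.cEnd D) (hI : H.CondI e S) :
    l = 3 * m ∧ H.form S (e 0) (e 0) (e 2) (e 2) = -(3 / 2) ∧
      H.form S (e 0) (e 1) (e 2) (e 3) = -(3 / 4) ∧ H.form S (e 1) (e 1) (e 3) (e 3) = 1 / 2 ∧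
      H.form S (e 0) (e 3) (e 3) (e 3) * H.form S (e 1) (e 1) (e 1) (e 2) = -3 := by
  have he := h.adapted
  have hlt : m < l := lt_of_le_of_ne hml (h.ne_of_conditions hl hS hT hI)
  have hl' : (l : ℂ) ≠ 0 := Complex.ofReal_ne_zero.mpr hl.ne'
  have E0 := h.eigenvalue_eq hT (e 0) (e 2)
  have E1 := h.eigenvalue_eq hT (e 1) (e 3)
  rw [h.eigen_zero, map_smul, LinearMap.smul_apply, ← he.j0, he.π_j_eq_repr, e.repr_self,
    Finsupp.single_eq_same, smul_eq_mul, he.j0, form_pair_swap S (e 1) (e 3),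
    H.form_swap12 S (e 0) (e 2) (e 0), H.form_swap12 S (e 0) (e 2) (e 1)] at E0
  rw [h.eigen_one, map_smul, LinearMap.smul_apply, ← he.j1, he.π_j_eq_repr, e.repr_self,
    Finsupp.single_eq_same, smul_eq_mul, he.j1,
    H.form_swap12 S (e 0) (e 2) (e 1), H.form_swap12 S (e 1) (e 3) (e 1)] at E1
  rw [he.condI_iff_quadContr] at hI
  have I1 := hI 0 0 2 2
  have I2 := hI 0 1 2 3
  have I3 := hI 0 3 2 1
  have p02 : H.π (e 0) (e 2) = 1 := by simp [he.π_eq]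
  have p13 : H.π (e 1) (e 3) = 1 := by simp [he.π_eq]
  have p03 : H.π (e 0) (e 3) = 0 := by simp [he.π_eq]
  have p12 : H.π (e 1) (e 2) = 0 := by simp [he.π_eq]
  have p31 : H.π (e 3) (e 1) = -1 := by simp [he.π_eq]
  have p01 : H.π (e 0) (e 1) = 0 := by simp [he.π_eq]
  rw [p02] at I1
  rw [p02, p13, p03, p12] at I2
  rw [p02, p31, p01] at I3
  -- in each of the three contractions below, weights leave only the terms that are not covered by
  -- `z1`, `z2`, `z3`
  have z1 : ∀ σ μ : Fin 4, ¬(σ = 2 ∧ μ = 2) → H.form S (e σ) (e μ) (e 0) (e 0) = 0 := by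
    intro σ μ hn
    refine h.form_eq_zero hS fun hw => hn ?_
    fin_cases σ <;> fin_cases μ <;>
      first
        | decide
        | (simp only [weight, Fin.zero_eta, Fin.mk_one, Fin.reduceFinMk, Matrix.cons_val] at hw
           linarith)
  have q1 : H.quadContr e S (e 0) (e 0) (e 2) (e 2) =
      H.form S (e 0) (e 0) (e 2) (e 2) ^ 2 := by
    rw [quadContr, Finset.sum_eq_single 2, Finset.sum_eq_single 2]
    · simp only [he.j2, map_neg, LinearMap.neg_apply, neg_neg]
      rw [form_pair_swap S (e 2) (e 2), sq]
    · intro μ _ hμ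
      rw [z1 _ _ fun hn => hμ hn.2, zero_mul]
    · simp
    · intro σ _ hσ
      exact Finset.sum_eq_zero fun μ _ => by rw [z1 _ _ fun hn => hσ hn.1, zero_mul]
    · simp
  have a_cases : (H.form S (e 0) (e 0) (e 2) (e 2) - 7 / 2) *
      (H.form S (e 0) (e 0) (e 2) (e 2) + 3 / 2) = 0 := by
    linear_combination I1 - q1
  have hm0 : 0 < m := by
    refine lt_of_le_of_ne hm fun h0 => ?_
    rw [← h0, Complex.ofReal_zero, zero_mul, add_zero] at E0
    have ha : H.form S (e 0) (e 0) (e 2) (e 2) = -(7 / 4) := by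
      refine mul_left_cancel₀ hl' ?_
      linear_combination E0 + (7 / 4 : ℂ) * l * Complex.I_mul_I
    rw [ha] at a_cases
    norm_num at a_cases
  have hm' : (m : ℂ) ≠ 0 := Complex.ofReal_ne_zero.mpr hm0.ne'
  have z2 : ∀ σ μ : Fin 4, ¬(σ = 2 ∧ μ = 3 ∨ σ = 3 ∧ μ = 2) →
      H.form S (e σ) (e μ) (e 0) (e 1) = 0 := by
    intro σ μ hn
    refine h.form_eq_zero hS fun hw => hn ?_
    fin_cases σ <;> fin_cases μ <;>
      first
        | decide
        | (simp only [weight, Fin.zero_eta, Fin.mk_one, Fin.reduceFinMk, Matrix.cons_val] at hw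
           linarith)
  have q2 : H.quadContr e S (e 0) (e 1) (e 2) (e 3) =
      2 * H.form S (e 0) (e 1) (e 2) (e 3) ^ 2 := by
    simp only [quadContr, Fin.sum_univ_four,
      z2 0 0 (by decide), z2 0 1 (by decide), z2 0 2 (by decide), z2 0 3 (by decide),
      z2 1 0 (by decide), z2 1 1 (by decide), z2 1 2 (by decide), z2 1 3 (by decide),
      z2 2 0 (by decide), z2 2 1 (by decide), z2 2 2 (by decide), z2 3 0 (by decide),
      z2 3 1 (by decide), z2 3 3 (by decide), he.j2, he.j3, map_neg, LinearMap.neg_apply]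
    rw [H.form_swap01 S (e 3) (e 2), H.form_swap01 S (e 1) (e 0), form_pair_swap S (e 2) (e 3)]
    ring
  have z3 : ∀ σ μ : Fin 4, ¬(σ = 1 ∧ μ = 2 ∨ σ = 2 ∧ μ = 1 ∨ σ = 3 ∧ μ = 3) →
      H.form S (e σ) (e μ) (e 0) (e 3) = 0 := by
    intro σ μ hn
    refine h.form_eq_zero hS fun hw => hn ?_
    fin_cases σ <;> fin_cases μ <;>
      first
        | decide
        | (simp only [weight, Fin.zero_eta, Fin.mk_one, Fin.reduceFinMk, Matrix.cons_val] at hw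
           linarith)
  have q3 : H.quadContr e S (e 0) (e 3) (e 2) (e 1) =
      -2 * H.form S (e 0) (e 1) (e 2) (e 3) ^ 2 +
        H.form S (e 0) (e 3) (e 3) (e 3) * H.form S (e 1) (e 1) (e 1) (e 2) := by
    simp only [quadContr, Fin.sum_univ_four,
      z3 0 0 (by decide), z3 0 1 (by decide), z3 0 2 (by decide), z3 0 3 (by decide),
      z3 1 0 (by decide), z3 1 1 (by decide), z3 1 3 (by decide), z3 2 0 (by decide),
      z3 2 2 (by decide), z3 2 3 (by decide), z3 3 0 (by decide), z3 3 1 (by decide),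
      z3 3 2 (by decide), he.j1, he.j2, he.j3, map_neg, LinearMap.neg_apply]
    rw [H.form_swap01 S (e 2) (e 1), H.form_swap01 S (e 3) (e 0),
      H.form_swap23 S (e 0) (e 3) (e 2) (e 1), H.form_swap12 S (e 0) (e 3) (e 1) (e 2),
      H.form_swap23 S (e 0) (e 1) (e 3) (e 2), form_pair_swap S (e 1) (e 2) (e 0) (e 3),
      H.form_swap12 S (e 0) (e 3) (e 1) (e 2), H.form_swap23 S (e 0) (e 1) (e 3) (e 2),
      form_pair_swap S (e 3) (e 3) (e 0) (e 3), H.form_swap23 S (e 1) (e 1) (e 2) (e 1)]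
    ring
  rw [q2] at I2
  rw [q3, H.form_swap23 S (e 0) (e 3) (e 2) (e 1), H.form_swap12 S (e 0) (e 3) (e 1) (e 2),
    H.form_swap23 S (e 0) (e 1) (e 3) (e 2)] at I3
  -- without the extra product of components, `I2` and `I3` would force opposite signs on the same
  -- quantity
  have hlm : l = 3 * m := by
    by_contra hne
    have hd : H.form S (e 0) (e 3) (e 3) (e 3) = 0 :=
      h.form_eq_zero hS fun hw => hne (by
        simp only [weight, Matrix.cons_val] at hw
        linarith)
    rw [hd, zero_mul, add_zero] at I3
    have hb : H.form S (e 0) (e 1) (e 2) (e 3) = 0 := by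
      linear_combination -(I2 + I3) / 4
    rw [hb] at I2
    norm_num at I2
  have hlC : (l : ℂ) = 3 * m := by
    rw [hlm]
    push_cast
    rfl
  rw [hlC] at E0 E1
  have F0 : 3 * H.form S (e 0) (e 0) (e 2) (e 2) + H.form S (e 0) (e 1) (e 2) (e 3) =
      -(21 / 4) := by
    refine mul_left_cancel₀ hm' ?_
    linear_combination E0 + (21 / 4 : ℂ) * m * Complex.I_mul_I
  have F1 : 3 * H.form S (e 0) (e 1) (e 2) (e 3) + H.form S (e 1) (e 1) (e 3) (e 3) =
      -(7 / 4) := by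
    refine mul_left_cancel₀ hm' ?_
    linear_combination E1 + (7 / 4 : ℂ) * m * Complex.I_mul_I
  have ha : H.form S (e 0) (e 0) (e 2) (e 2) = -(3 / 2) := by
    rcases mul_eq_zero.mp a_cases with h0 | h0
    · exfalso
      have hb : H.form S (e 0) (e 1) (e 2) (e 3) = -(63 / 4) := by
        linear_combination F0 - 3 * h0
      rw [hb] at I2
      norm_num at I2
    · linear_combination h0
  have hb : H.form S (e 0) (e 1) (e 2) (e 3) = -(3 / 4) := by
    linear_combination F0 - 3 * ha
  refine ⟨hlm, ha, hb, by linear_combination F1 - 3 * hb, ?_⟩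
  rw [hb] at I3
  linear_combination I3

end IsEigenbasis

/-! ### Recovering the discriminant -/

/-- A symmetric tensor whose components of nonzero weight vanish is determined by five
components; the weights are those of the irreducible four-dimensional representation of `su(2)`,
multiplied by `2`. -/
theorem eq_zero_of_weight (Z : Fin 4 → Fin 4 → Fin 4 → Fin 4 → ℂ)
    (s01 : ∀ α β γ δ, Z α β γ δ = Z β α γ δ) (s12 : ∀ α β γ δ, Z α β γ δ = Z α γ β δ)
    (s23 : ∀ α β γ δ, Z α β γ δ = Z α β δ γ)
    (hw : ∀ α β γ δ, (![3, 1, -3, -1] α + ![3, 1, -3, -1] β + ![3, 1, -3, -1] γ +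
      ![3, 1, -3, -1] δ : ℤ) ≠ 0 → Z α β γ δ = 0)
    (ha : Z 0 0 2 2 = 0) (hb : Z 0 1 2 3 = 0) (hc : Z 1 1 3 3 = 0) (hd : Z 0 3 3 3 = 0)
    (hd' : Z 1 1 1 2 = 0) (α β γ δ : Fin 4) : Z α β γ δ = 0 := by
  have sorted : ∀ a b c d, a ≤ b → b ≤ c → c ≤ d → Z a b c d = 0 := by
    intro a b c d hab hbc hcd
    fin_cases a <;> fin_cases b <;> fin_cases c <;> fin_cases d <;>
      first
        | exact ha
        | exact hb
        | exact hc
        | exact hd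
        | exact hd'
        | exact hw _ _ _ _ (by decide)
        | (exfalso; revert hab hbc hcd; decide)
  -- insertion of the arguments one after the other into a sorted list
  have insert_a : ∀ a b c d, b ≤ c → c ≤ d → Z a b c d = 0 := by
    intro a b c d hbc hcd
    rcases le_total a b with h | h
    · exact sorted a b c d h hbc hcd
    rw [s01]
    rcases le_total a c with h' | h'
    · exact sorted b a c d h h' hcd
    rw [s12]
    rcases le_total a d with h'' | h''
    · exact sorted b c a d hbc h' h''
    rw [s23]
    exact sorted b c d a hbc hcd h''
  have insert_b : ∀ a b c d, c ≤ d → Z a b c d = 0 := by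
    intro a b c d hcd
    rcases le_total b c with h | h
    · exact insert_a a b c d h hcd
    rw [s12]
    rcases le_total b d with h' | h'
    · exact insert_a a c b d h h'
    rw [s23]
    exact insert_a a c d b hcd h'
  rcases le_total γ δ with h | h
  · exact insert_b α β γ δ h
  · rw [s23]
    exact insert_b α β δ γ h

theorem discPolar_weight (α β γ δ : Fin 4)
    (hw : (![3, 1, -3, -1] α + ![3, 1, -3, -1] β + ![3, 1, -3, -1] γ +
      ![3, 1, -3, -1] δ : ℤ) ≠ 0) :
    discPolar (Pi.single α 1) (Pi.single β 1) (Pi.single γ 1) (Pi.single δ 1) = 0 := by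
  let u : Fin 4 → ℤ := ![3, 1, -3, -1]
  let v : Fin 4 → ℂ := ![3, 1, -3, -1]
  have huv : ∀ α, (u α : ℂ) = v α := by
    intro α
    fin_cases α <;> simp [u, v]
  -- the torus acts trivially on `disc`; this is the infinitesimal form of that fact
  have key : ∀ x y z t : Fin 4 → ℂ, discPolar (v * x) y z t + discPolar x (v * y) z t +
      discPolar x y (v * z) t + discPolar x y z (v * t) = 0 := by
    intro x y z t
    simp only [discPolar, Pi.mul_apply, v, Matrix.cons_val]
    ring
  have smul : ∀ (c : ℂ) (x y z t : Fin 4 → ℂ), discPolar (c • x) y z t = c * discPolar x y z t := by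
    intro c x y z t
    simp only [discPolar, Pi.smul_apply, smul_eq_mul]
    ring
  have hv : ∀ α, v * Pi.single α 1 = v α • Pi.single α 1 := by
    intro α
    funext i
    by_cases h : i = α
    · subst h; simp
    · simp [h]
  have h := key (Pi.single α 1) (Pi.single β 1) (Pi.single γ 1) (Pi.single δ 1)
  set a : Fin 4 → ℂ := Pi.single α 1
  set b : Fin 4 → ℂ := Pi.single β 1
  set c : Fin 4 → ℂ := Pi.single γ 1
  set d : Fin 4 → ℂ := Pi.single δ 1
  rw [hv, hv, hv, hv, discPolar_swap01 a, discPolar_swap12 a b, discPolar_swap01 a (v γ • c),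
    discPolar_swap23 a b c, discPolar_swap12 a b (v δ • d), discPolar_swap01 a (v δ • d),
    smul, smul, smul, smul, discPolar_swap01 b a, discPolar_swap01 c a, discPolar_swap12 a c,
    discPolar_swap01 d a, discPolar_swap12 a d, discPolar_swap23 a b d] at h
  have h' : ((u α + u β + u γ + u δ : ℤ) : ℂ) * discPolar a b c d = 0 := by
    push_cast
    rw [huv, huv, huv, huv]
    linear_combination h
  exact (mul_eq_zero.mp h').resolve_left (Int.cast_ne_zero.mpr hw)

/-- The quartic form is the discriminant as soon as the components of weight zero agree. -/
theorem eq_disc_of_components (S : H.symTensors)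
    (hw : ∀ α β γ δ, (![3, 1, -3, -1] α + ![3, 1, -3, -1] β + ![3, 1, -3, -1] γ +
      ![3, 1, -3, -1] δ : ℤ) ≠ 0 → H.form S (e α) (e β) (e γ) (e δ) = 0)
    (ha : H.form S (e 0) (e 0) (e 2) (e 2) = -(3 / 2))
    (hb : H.form S (e 0) (e 1) (e 2) (e 3) = -(3 / 4))
    (hc : H.form S (e 1) (e 1) (e 3) (e 3) = 1 / 2)
    (hd : H.form S (e 0) (e 3) (e 3) (e 3) = (√3 : ℝ))
    (hd' : H.form S (e 1) (e 1) (e 1) (e 2) = -(√3 : ℝ)) (x : W) :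
    S.1 ![H.ι x, H.ι x, H.ι x, H.ι x] = disc (e.repr x) := by
  let f : W → W → W → W → ℂ := fun x y z w => H.form S x y z w -
    discPolar (e.repr x) (e.repr y) (e.repr z) (e.repr w)
  have hf : ∀ α β γ δ, f (e α) (e β) (e γ) (e δ) = H.form S (e α) (e β) (e γ) (e δ) -
      discPolar (Pi.single α 1) (Pi.single β 1) (Pi.single γ 1) (Pi.single δ 1) := by
    intro α β γ δ
    simp only [f, e.repr_self, Finsupp.single_eq_pi_single]
  have hz : ∀ α β γ δ, f (e α) (e β) (e γ) (e δ) = 0 := by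
    refine eq_zero_of_weight (fun α β γ δ => f (e α) (e β) (e γ) (e δ)) ?_ ?_ ?_ ?_ ?_ ?_ ?_ ?_ ?_
    · intro α β γ δ
      simp only [f]
      rw [H.form_swap01, discPolar_swap01]
    · intro α β γ δ
      simp only [f]
      rw [H.form_swap12, discPolar_swap12]
    · intro α β γ δ
      simp only [f]
      rw [H.form_swap23, discPolar_swap23]
    · intro α β γ δ h
      rw [hf, hw _ _ _ _ h, discPolar_weight _ _ _ _ h, sub_zero]
    · rw [hf, ha]; simp [discPolar]
    · rw [hf, hb]; simp [discPolar]
    · rw [hf, hc]; simp [discPolar]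
    · rw [hf, hd]; simp [discPolar]
    · rw [hf, hd']; simp [discPolar]
  have h := sum_components e f ?_ ?_ ?_ ?_ (e.repr x)
  · simp only [hz, zero_mul, Finset.sum_const_zero, e.sum_repr] at h
    simp only [f, discPolar_diag] at h
    exact (sub_eq_zero.mp h.symm)
  all_goals
    intro a b c
    constructor
    · intro u v
      simp only [f, discPolar, map_add, LinearMap.add_apply, Finsupp.coe_add, Pi.add_apply]
      ring
    · intro r u
      simp only [f, discPolar, map_smul, LinearMap.smul_apply, Finsupp.coe_smul, Pi.smul_apply,
        smul_eq_mul]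
      ring

namespace IsAdapted

/-- The projection `P` does not vanish: `𝒯 = -3/2` is impossible for a totally symmetric `S`. -/
theorem exists_P_ne_zero (he : H.IsAdapted e) [FiniteDimensional ℂ W] (S : H.symTensors) :
    ∃ A : H.sp, H.P (H.𝒦 S) A ≠ 0 := by
  by_contra! hP
  let φ : Module.End ℂ W →ₗ[ℂ] Module.End ℂ W := H.opC e S + (3 / 2 : ℂ) • LinearMap.id
  have hφ : ∀ B : H.sp, φ (H.cEnd B) = 0 := by
    intro B
    have h1 : H.𝒯 (H.𝒦 S) B = (-(3 / 2) : ℝ) • B := by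
      have h2 : (5 : ℝ) • H.P (H.𝒦 S) B = H.𝒯 (H.𝒦 S) B + (3 / 2 : ℝ) • B := by
        simp only [P, LinearMap.add_apply, LinearMap.smul_apply, LinearMap.id_apply]
        module
      rw [hP, smul_zero] at h2
      rw [neg_smul]
      exact eq_neg_of_add_eq_zero_left h2.symm
    have h3 : φ (H.cEnd B) = H.opC e S (H.cEnd B) + (3 / 2 : ℂ) • H.cEnd B := rfl
    rw [h3, ← he.cEnd_𝒯, h1]
    ext x
    have r : ∀ (c : ℝ) (x : W), c • x = (c : ℂ) • x := fun c x => (algebraMap_smul ℂ c x).symm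
    have h4 : H.cEnd ((-(3 / 2) : ℝ) • B) x = (-(3 / 2) : ℝ) • B.1 x := rfl
    rw [LinearMap.add_apply, LinearMap.smul_apply, h4, cEnd_apply, r, ← add_smul]
    push_cast
    rw [neg_add_cancel, zero_smul, LinearMap.zero_apply]
  have h : ∀ u v x y, 2 * H.form S x y u v +
      3 / 2 * (H.π u x * H.π v y + H.π v x * H.π u y) = 0 := by
    intro u v x y
    have h1 := congrArg (fun B => H.π (B x) y) (H.map_symEnd_eq_zero φ hφ u v)
    simpa only [φ, LinearMap.add_apply, LinearMap.smul_apply, LinearMap.id_apply, map_add, map_smul,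
      he.π_opC_symEnd, π_symEnd, smul_eq_mul, LinearMap.zero_apply, map_zero] using h1
  have h1 := h (e 0) (e 0) (e 2) (e 2)
  have h2 := h (e 0) (e 2) (e 0) (e 2)
  have p02 : H.π (e 0) (e 2) = 1 := by simp [he.π_eq]
  have p20 : H.π (e 2) (e 0) = -1 := by simp [he.π_eq]
  rw [p02, form_pair_swap] at h1
  rw [p02, p20, H.π_self, H.π_self, H.form_swap12] at h2
  have h3 : (9 / 2 : ℂ) = 0 := by linear_combination h1 - h2
  norm_num at h3

/-- The two conditions force the quartic form to be a discriminant. -/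
theorem mem_𝒞_of_conditions (he : H.IsAdapted e) [FiniteDimensional ℂ W] (S : H.symTensors)
    (hI : H.CondI e S) (hII : H.CondII e S) : H.𝒦 S ∈ H.𝒞 := by
  have hPP := he.condI_iff S |>.mp hI
  obtain ⟨A, hA⟩ := he.exists_P_ne_zero S
  have hD := (he.condII_iff_P S).mp hII A
  have hPD : H.P (H.𝒦 S) (H.P (H.𝒦 S) A) = H.P (H.𝒦 S) A := LinearMap.congr_fun hPP A
  set D := H.P (H.𝒦 S) A
  have hTD : H.𝒯 (H.𝒦 S) D = (7 / 2 : ℝ) • D := by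
    have h2 : (5 : ℝ) • H.P (H.𝒦 S) D = H.𝒯 (H.𝒦 S) D + (3 / 2 : ℝ) • D := by
      simp only [P, LinearMap.add_apply, LinearMap.smul_apply, LinearMap.id_apply]
      module
    rw [hPD] at h2
    rw [eq_comm, ← eq_sub_iff_add_eq] at h2
    rw [h2]
    module
  have hT : ∀ {e : Module.Basis (Fin 4) ℂ W}, H.IsAdapted e →
      H.opC e S (H.cEnd D) = (7 / 2 : ℂ) • H.cEnd D := by
    intro e he
    rw [← he.cEnd_𝒯, hTD]
    ext x
    have r : ∀ (c : ℝ) (x : W), c • x = (c : ℂ) • x := fun c x => (algebraMap_smul ℂ c x).symm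
    have h4 : H.cEnd ((7 / 2 : ℝ) • D) x = (7 / 2 : ℝ) • D.1 x := rfl
    rw [LinearMap.smul_apply, h4, cEnd_apply, r]
    push_cast
    rfl
  obtain ⟨e₁, he₁, l, m, hm, hml, hl0, hm1⟩ := exists_adapted_eigenbasis
    (by rw [Module.finrank_eq_card_basis e, Fintype.card_fin]) D
  have h₁ : H.IsEigenbasis e₁ D l m := ⟨he₁, hl0, hm1⟩
  have hl : 0 < l := by
    refine lt_of_le_of_ne (hm.trans hml) fun h0 => hA ?_
    have hm0 : m = 0 := le_antisymm (h0 ▸ hml) hm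
    have hc : H.cEnd D = 0 := e₁.ext fun α => by
      rw [cEnd_apply, h₁.apply_basis, ← h0, hm0]
      fin_cases α <;> simp [weight]
    exact Subtype.ext (LinearMap.ext fun x => LinearMap.congr_fun hc x)
  have hI' : ∀ {e' : Module.Basis (Fin 4) ℂ W}, H.IsAdapted e' → H.CondI e' S := fun he' =>
    (he'.condI_iff S).mpr hPP
  obtain ⟨-, -, -, -, hdd⟩ := h₁.components hl hm hml hD (hT he₁) (hI' he₁)
  set d := H.form S (e₁ 0) (e₁ 3) (e₁ 3) (e₁ 3) with hd
  have hconj : H.form S (e₁ 1) (e₁ 1) (e₁ 1) (e₁ 2) = -starRingEnd ℂ d := by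
    rw [hd, ← H.form_j, he₁.j0, he₁.j3]
    simp only [map_neg, LinearMap.neg_apply, neg_neg]
    rw [H.form_swap01 S (e₁ 2), H.form_swap12 S (e₁ 1) (e₁ 2), H.form_swap23 S (e₁ 1) (e₁ 1)]
  have hnorm : d * starRingEnd ℂ d = 3 := by
    rw [hconj] at hdd
    linear_combination -hdd
  have hd0 : d ≠ 0 := by
    intro h0
    rw [h0, zero_mul] at hnorm
    norm_num at hnorm
  have h3 : ((√3 : ℝ) : ℂ) * ((√3 : ℝ) : ℂ) = 3 := by
    rw [← Complex.ofReal_mul, Real.mul_self_sqrt (by norm_num)]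
    norm_num
  -- rotating the first basis vector by `√3 / d` makes the component `d` equal to `√3`
  have hζ : ((√3 : ℝ) / d : ℂ) * starRingEnd ℂ ((√3 : ℝ) / d : ℂ) = 1 := by
    rw [map_div₀, Complex.conj_ofReal, div_mul_div_comm, h3, hnorm, div_self (by norm_num)]
  obtain ⟨e₂, he₂, h20, h21⟩ := he₁.exists_rotate hζ
  have h₂ : H.IsEigenbasis e₂ D l m := by
    refine ⟨he₂, ?_, ?_⟩
    · rw [h20, ← cEnd_apply, map_smul, cEnd_apply, hl0, smul_comm]
    · rw [h21, hm1]
  obtain ⟨hlm, ha, hb, hc, hdd₂⟩ := h₂.components hl hm hml hD (hT he₂) (hI' he₂)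
  have hd₂ : H.form S (e₂ 0) (e₂ 3) (e₂ 3) (e₂ 3) = (√3 : ℝ) := by
    rw [← he₂.j1, h20, h21, he₁.j1, map_smul, LinearMap.smul_apply, LinearMap.smul_apply,
      LinearMap.smul_apply, ← hd, smul_eq_mul, div_mul_cancel₀ _ hd0]
  have hs0 : ((√3 : ℝ) : ℂ) ≠ 0 := by
    intro h0
    rw [h0, zero_mul] at h3
    norm_num at h3
  refine ⟨S, rfl, e₂, he₂, eq_disc_of_components S (fun α β γ δ hw => ?_) ha hb hc hd₂ ?_⟩
  · refine h₂.form_eq_zero hD ?_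
    have hwt : ∀ α, weight l m α = m * ((![3, 1, -3, -1] α : ℤ) : ℝ) := by
      intro α
      rw [hlm]
      fin_cases α <;> simp [weight] <;> ring
    have hm0 : m ≠ 0 := by
      rintro rfl
      rw [hlm] at hl
      norm_num at hl
    rw [hwt, hwt, hwt, hwt, ← mul_add, ← mul_add, ← mul_add]
    exact mul_ne_zero hm0 (by exact_mod_cast hw)
  · rw [hd₂] at hdd₂
    refine mul_left_cancel₀ hs0 ?_
    rw [hdd₂, mul_neg, h3]

end IsAdapted

end

end HyperHermitian

theorem mainTheorem10 {W : Type*} [AddCommGroup W] [Module ℂ W] [FiniteDimensional ℂ W]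
    (H : HyperHermitian W) (e : Module.Basis (Fin 4) ℂ W) (he : H.IsAdapted e)
    (S : H.symTensors) :
    (H.𝒦 S ∈ H.𝒞 ↔ H.CondI e S ∧ H.CondII e S) ∧
    (H.CondI e S ↔ H.P (H.𝒦 S) ∘ₗ H.P (H.𝒦 S) = H.P (H.𝒦 S)) ∧
    (H.CondII e S ↔ ∀ A B : H.sp,
      ⁅H.P (H.𝒦 S) A, H.P (H.𝒦 S) B⁆ = H.P (H.𝒦 S) ⁅H.P (H.𝒦 S) A, B⁆) := by
  refine ⟨⟨?_, fun h => he.mem_𝒞_of_conditions S h.1 h.2⟩, he.condI_iff S, he.condII_iff S⟩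
  -- both conditions are independent of the adapted basis, so a basis that exhibits the
  -- discriminant may be used
  rintro ⟨S', hS', e', he', hdisc⟩
  obtain rfl := H.𝒦_injective hS'
  exact ⟨(he.condI_iff S').mpr ((he'.condI_iff S').mp (he'.condI_of_disc S' hdisc)),
    (he.condII_iff S').mpr ((he'.condII_iff S').mp (he'.condII_of_disc S' hdisc))⟩
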